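/- Let $\mathbb F_q$ be a finite field, $A=\mathbb F_q[T]$, $k=\mathbb F_q(T)$, and let $k_\infty=\mathbb F_q((1/T))$ be the completion of $k$ at the place $\infty$ given by $v_\infty=-\deg_T$. Let $f\in k_\infty$ be a quadratic unit, i.e. a root of $X^2-aX-b$ with $a\in A$, $d:=\deg_T(a)>0$ and $b\in\mathbb F_q^{*}$, and let $K=k(f)\subset k_\infty$. Let $\mathcal O_K$ be the integral closure of $A$ in $K$. Let $\infty_1$ be any place of $K$ lying over $\infty$, and let $A_{\infty_1}\subset K$ be the ring of functions regular outside of $\infty_1$. Let $h_K$ be the number of divisor classes of degree $0$ of $K/\mathbb F_q$, and let $h_{A_{\infty_1}}$, $h_{\mathcal O_K}$ be the orders of the ideal class groups of $A_{\infty_1}$ and $\mathcal O_K$. Then these three numbers are finite and $$h_K=h_{A_{\infty_1}}.$$ If moreover $f$ is a fundamental unit of $K$, i.e. $\mathcal O_K^{*}=\{c f^n : c\in\mathbb F_q^{*},\ n\in\mathbb Z\}$, then $$h_{A_{\infty_1}}=d\cdot h_{\mathcal O_K},$$ so that $h_K=h_{A_{\infty_1}}=d\cdot h_{\mathcal O_K}$.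 -/

import Mathlib

open scoped Polynomial

noncomputable section

/-! ### Places, divisors and class numbers of a function field `K` with constant field `F` -/

/-- A place (prime) of `K / F`: a discrete valuation ring with fraction field `K` that contains the
constant field `F`. -/
@[ext]
structure FFPlace (F K : Type*) [Field F] [Field K] [Algebra F K] where
  /-- the valuation ring of the place -/
  ring : ValuationSubring K
  algebraMap_mem : ∀ c : F, algebraMap F K c ∈ ring
  isDVR : IsDiscreteValuationRing ring

namespace FFPlace

variable {F K : Type*} [Field F] [Field K] [Algebra F K]

instance (P : FFPlace F K) : IsDiscreteValuationRing P.ring := P.isDVR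

instance (P : FFPlace F K) : Algebra F P.ring :=
  ((algebraMap F K).codRestrict P.ring P.algebraMap_mem).toAlgebra

/-- The degree of a place: the degree of its residue field over the constant field. -/
def degree (P : FFPlace F K) : ℕ :=
  Module.finrank F (IsLocalRing.ResidueField P.ring)

/-- The normalized order of vanishing `ord_P(x) ∈ ℤ` of a nonzero function `x` at `P`. -/
def ord (P : FFPlace F K) (x : Kˣ) : ℤ :=
  -WithZero.log ((IsDiscreteValuationRing.maximalIdeal P.ring).valuation K (x : K))

theorem ord_one (P : FFPlace F K) : P.ord 1 = 0 := by
  simp [ord]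

theorem ord_mul (P : FFPlace F K) (x y : Kˣ) : P.ord (x * y) = P.ord x + P.ord y := by
  unfold ord
  rw [Units.val_mul, map_mul, WithZero.log_mul (by simp) (by simp)]
  ring

theorem ord_inv (P : FFPlace F K) (x : Kˣ) : P.ord x⁻¹ = -P.ord x := by
  unfold ord
  rw [Units.val_inv_eq_inv_val, map_inv₀, WithZero.log_inv]

end FFPlace

/-- The divisor group: the free abelian group on the places. -/
abbrev FFDivisor (F K : Type*) [Field F] [Field K] [Algebra F K] : Type _ := FFPlace F K →₀ ℤ

namespace FFDivisor

variable (F K : Type*) [Field F] [Field K] [Algebra F K]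

/-- The degree of a divisor, `∑ n_P P ↦ ∑ n_P deg P`. -/
def degree : FFDivisor F K →+ ℤ :=
  Finsupp.liftAddHom fun P : FFPlace F K => zmultiplesHom ℤ (P.degree : ℤ)

/-- The group of principal divisors `div(x) = ∑ ord_P(x) P`, for `x` a nonzero function. -/
def principal : AddSubgroup (FFDivisor F K) where
  carrier := {D | ∃ x : Kˣ, ∀ P : FFPlace F K, D P = P.ord x}
  zero_mem' := ⟨1, fun P => by simp [P.ord_one]⟩
  add_mem' := by
    rintro D E ⟨x, hx⟩ ⟨y, hy⟩
    exact ⟨x * y, fun P => by simp [hx P, hy P, P.ord_mul]⟩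
  neg_mem' := by
    rintro D ⟨x, hx⟩
    exact ⟨x⁻¹, fun P => by simp [hx P, P.ord_inv]⟩

end FFDivisor

/-- The group of divisor classes of degree zero. -/
abbrev FFDegreeZeroClassGroup (F K : Type*) [Field F] [Field K] [Algebra F K] : Type _ :=
  (FFDivisor.degree F K).ker ⧸ (FFDivisor.principal F K).addSubgroupOf (FFDivisor.degree F K).ker

/-- The ring of functions in `K` that are regular outside of the place `P`. -/
def regularOutside {F K : Type*} [Field F] [Field K] [Algebra F K] (P : FFPlace F K) : Subring K :=
  ⨅ (Q : FFPlace F K) (_ : Q ≠ P), Q.ring.toSubring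

/-! ### Subfields of `k_∞ = F((1/T))`, the completion of `k = F(T)` at infinity -/

section CompletionAtInfty

variable {F : Type*} [Field F] [DecidableEq (RatFunc F)]

instance : Algebra F (RatFunc.CompletionAtInfty F) :=
  Algebra.compHom _ (algebraMap F (RatFunc F))

instance : IsScalarTower F (RatFunc F) (RatFunc.CompletionAtInfty F) :=
  IsScalarTower.of_algebraMap_eq fun _ => rfl

instance : Algebra F[X] (RatFunc.CompletionAtInfty F) :=
  Algebra.compHom _ (algebraMap F[X] (RatFunc F))

instance : IsScalarTower F[X] (RatFunc F) (RatFunc.CompletionAtInfty F) :=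
  IsScalarTower.of_algebraMap_eq fun _ => rfl

instance : IsScalarTower F F[X] (RatFunc.CompletionAtInfty F) :=
  IsScalarTower.of_algebraMap_eq fun c => by
    rw [IsScalarTower.algebraMap_apply F (RatFunc F) (RatFunc.CompletionAtInfty F),
      IsScalarTower.algebraMap_apply F[X] (RatFunc F) (RatFunc.CompletionAtInfty F),
      ← IsScalarTower.algebraMap_apply F F[X] (RatFunc F)]

/-- The subfield `k(f)` of `k_∞` generated over `k = F(T)` by `f`. -/
abbrev simpleExt (f : RatFunc.CompletionAtInfty F) :
    IntermediateField (RatFunc F) (RatFunc.CompletionAtInfty F) :=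
  IntermediateField.adjoin (RatFunc F) {f}

/-- A place of an extension `K` of `k = F(T)` lies over `∞` if its valuation ring restricts
to the valuation ring of `v_∞ = -deg` on `k`. -/
def FFPlace.LiesOverInfty {K : Type*} [Field K] [Algebra F K] [Algebra (RatFunc F) K]
    (P : FFPlace F K) : Prop :=
  P.ring.comap (algebraMap (RatFunc F) K) = (RatFunc.inftyValuation F).valuationSubring

/-- `f` is a fundamental unit of `K = k(f)`: the units of the
integral closure `O_K` of `F[T]` in `K` are exactly the elements `c f ^ n` with `c` a
nonzero constant and `n` an integer. -/
def IsFundamentalUnit (f : RatFunc.CompletionAtInfty F) : Prop :=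
  ∀ x : RatFunc.CompletionAtInfty F,
    (∃ u : (FunctionField.ringOfIntegers F (simpleExt f))ˣ,
      (((u : FunctionField.ringOfIntegers F (simpleExt f)) : simpleExt f) :
        RatFunc.CompletionAtInfty F) = x) ↔
    ∃ (c : Fˣ) (n : ℤ), x = algebraMap F (RatFunc.CompletionAtInfty F) c * f ^ n

end CompletionAtInfty

end

/-! The two roots `f` and `a - f` have product `-b`, a constant, and sum `a`, which has a pole at
every infinite place. So at each infinite place exactly one root is small and the other has the size
of `a`. Where `f` is small, it is the limit of the iteration `c ↦ -b / (a - c)` in `k`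
(`IsInfinite.val_sub_rootApprox_le`). Every element of `K` is then approximated there by elements of
`k`, so the place is unramified over `∞`, has degree one, and is the only infinite place where `f`
is small. Hence the infinite places are exactly `P` and its distinct conjugate `P.comap σ`, and `f`
has divisor `d (P - P.comap σ)`.

For a Dedekind domain `B` with fraction field `K` containing the constants, the places whose ring
contains `B` are the primes of `B`. Its class group is therefore the group of divisors modulo
principal divisors and divisors supported at the remaining places
(`FFDivisor.toClassGroup_eq_zero_iff`). As `P` has degree one, restriction to degree zero stays
surjective for both rings.

For functions regular outside `P`, only `P` is forgotten. Its coefficient is recovered from the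
degree because principal divisors have degree zero (`FFDivisor.exists_principal`), so the restricted
map is bijective (`nonempty_equiv_classGroup_regularOutside`). For `O_K`, both infinite places are
forgotten and the kernel is generated by the class of `P - P.comap σ` (`card_degreeZeroClassGroup`).
The divisor of `f` shows that `d` kills this class, which with finiteness of the class group of
`O_K` gives finiteness of all three groups. If `f` is fundamental the order is exactly `d`
(`addOrderOf_inftyClass`). -/

noncomputable section

open IsDedekindDomain WithZero
open scoped nonZeroDivisors

/-! ### Places as normalized valuations and as primes of Dedekind domains -/

section


/-- Two surjective valuations to `ℤᵐ⁰` with the same valuation ring are equal. -/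
theorem Valuation.eq_of_surjective_of_le_one_iff {K : Type*} [Field K] {v w : Valuation K ℤᵐ⁰}
    (hv : Function.Surjective v) (hw : Function.Surjective w)
    (h : ∀ x, v x ≤ 1 ↔ w x ≤ 1) : v = w := by
  have hlt : ∀ x, v x < 1 ↔ w x < 1 := by
    intro x
    by_cases hx : x = 0
    · simp [hx]
    · have := h x⁻¹
      rw [map_inv₀, map_inv₀, inv_le_one₀ (by simpa [zero_lt_iff] using hx),
        inv_le_one₀ (by simpa [zero_lt_iff] using hx)] at this
      rw [← not_le, ← not_le, this]
  have heq : ∀ x, v x = 1 ↔ w x = 1 := fun x => by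
    have h1 := h x
    have h2 := hlt x
    constructor <;> intro h3
    · exact le_antisymm (h1.1 h3.le) (not_lt.1 fun h4 => (h2.2 h4).ne h3)
    · exact le_antisymm (h1.2 h3.le) (not_lt.1 fun h4 => (h2.1 h4).ne h3)
  -- With `π` a uniformizer for `v`, every element is a power of `π` times a unit for both
  -- valuations, so `w` is determined by `w π`. Surjectivity of `w` then forces `w π = exp (-1)`.
  obtain ⟨π, hπ⟩ := hv (exp (-1))
  have hπ0 : π ≠ 0 := by rintro rfl; rw [map_zero] at hπ; exact exp_ne_zero hπ.symm
  have hwπ0 : w π ≠ 0 := by simpa using hπ0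
  have key : ∀ (x : K) (m : ℤ), v x = exp m → w x = w π ^ (-m) := by
    intro x m hx
    have h1 : v (x * π ^ m) = 1 := by
      rw [map_mul, map_zpow₀, hx, hπ, ← exp_zsmul, ← exp_add]
      simp
    have h2 := (heq _).1 h1
    rw [map_mul, map_zpow₀] at h2
    rw [zpow_neg]
    exact eq_inv_of_mul_eq_one_left h2
  have hex : ∀ x : K, x ≠ 0 → ∃ m : ℤ, v x = exp m := fun x hx =>
    ⟨log (v x), (exp_log (by simpa using hx)).symm⟩
  have hwπ : w π = exp (-1) := by
    obtain ⟨ρ, hρ⟩ := hw (exp (-1))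
    have hρ0 : ρ ≠ 0 := by rintro rfl; rw [map_zero] at hρ; exact exp_ne_zero hρ.symm
    obtain ⟨m, hm⟩ := hex ρ hρ0
    have h1 := key ρ m hm
    have h2 : w π = exp (log (w π)) := (exp_log hwπ0).symm
    have h3 : w π < 1 := (hlt π).1 (by rw [hπ, ← exp_zero, exp_lt_exp]; norm_num)
    rw [h2, ← exp_zero, exp_lt_exp] at h3
    rw [hρ, h2, ← exp_zsmul, exp_inj, smul_eq_mul] at h1
    have h4 : log (w π) ∣ 1 := ⟨m, by linarith⟩
    rcases Int.isUnit_iff.1 (isUnit_of_dvd_one h4) with h5 | h5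
    · omega
    · rw [h2, h5]
  ext x
  by_cases hx : x = 0
  · simp [hx]
  · obtain ⟨m, hm⟩ := hex x hx
    rw [key x m hm, hm, hwπ, ← exp_zsmul]
    simp

namespace FFPlace

variable {F K : Type*} [Field F] [Field K] [Algebra F K]

/-- The normalized valuation of a place. -/
def val (P : FFPlace F K) : Valuation K ℤᵐ⁰ :=
  (IsDiscreteValuationRing.maximalIdeal P.ring).valuation K

theorem ord_eq (P : FFPlace F K) (x : Kˣ) : P.ord x = -log (P.val x) := rfl

theorem val_eq_exp (P : FFPlace F K) (x : Kˣ) : P.val x = exp (-P.ord x) := by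
  rw [ord_eq, neg_neg, exp_log (by simp)]

theorem val_surjective (P : FFPlace F K) : Function.Surjective P.val :=
  HeightOneSpectrum.valuation_surjective K _

theorem val_le_one_iff (P : FFPlace F K) {x : K} : P.val x ≤ 1 ↔ x ∈ P.ring := by
  constructor
  · intro h
    obtain ⟨y, rfl⟩ := HeightOneSpectrum.mem_integers_of_valuation_le_one (R := P.ring) K x
      (fun v => by
        have : v = IsDiscreteValuationRing.maximalIdeal P.ring := by
          ext1
          exact IsLocalRing.eq_maximalIdeal (v.isPrime.isMaximal v.ne_bot)
        rw [this]; exact h)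
    exact y.2
  · intro h
    exact HeightOneSpectrum.valuation_le_one (K := K)
      (IsDiscreteValuationRing.maximalIdeal P.ring) ⟨x, h⟩

theorem val_lt_one_iff (P : FFPlace F K) (x : P.ring) :
    P.val x < 1 ↔ x ∈ IsLocalRing.maximalIdeal P.ring :=
  HeightOneSpectrum.valuation_lt_one_iff_mem (K := K)
    (IsDiscreteValuationRing.maximalIdeal P.ring) x

theorem val_algebraMap (P : FFPlace F K) {c : F} (hc : c ≠ 0) : P.val (algebraMap F K c) = 1 := by
  have h1 := P.val_le_one_iff.2 (P.algebraMap_mem c)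
  have h2 := P.val_le_one_iff.2 (P.algebraMap_mem c⁻¹)
  rw [map_inv₀, map_inv₀, inv_le_one₀ (by simpa [zero_lt_iff] using hc)] at h2
  exact le_antisymm h1 h2

theorem ring_ne_top (P : FFPlace F K) : P.ring ≠ ⊤ := by
  intro h
  obtain ⟨x, hx⟩ := P.val_surjective (exp 1)
  have h1 : P.val x ≤ 1 := P.val_le_one_iff.2 (h ▸ ValuationSubring.mem_top x)
  rw [hx, ← exp_zero, exp_le_exp] at h1
  norm_num at h1

/-- A valuation ring of dimension at most one has no proper overring in `K` except `K` itself.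
Identifying places thus needs only one inclusion. -/
theorem eq_of_ring_le {P Q : FFPlace F K} (h : P.ring ≤ Q.ring) : P = Q := by
  have : Ring.KrullDimLE 1 P.ring := inferInstance
  exact FFPlace.ext (ValuationSubring.eq_of_le_of_ne_top _ h Q.ring_ne_top)

theorem val_eq_of_surjective (P : FFPlace F K) {v : Valuation K ℤᵐ⁰} (hv : Function.Surjective v)
    (h : ∀ x, v x ≤ 1 ↔ x ∈ P.ring) : P.val = v :=
  Valuation.eq_of_surjective_of_le_one_iff P.val_surjective hv fun x => by
    rw [h, val_le_one_iff]

end FFPlace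

variable {F K B : Type*} [Field F] [Field K] [Algebra F K] [CommRing B] [IsDedekindDomain B]
  [Algebra B K] [IsFractionRing B K]

/-- The place given by a maximal ideal of a Dedekind domain with fraction field `K`. -/
def IsDedekindDomain.HeightOneSpectrum.toFFPlace
    (hF : ∀ c : F, algebraMap F K c ∈ (algebraMap B K).range) (v : HeightOneSpectrum B) : FFPlace F K where
  ring := (v.valuation K).valuationSubring
  algebraMap_mem c := by
    obtain ⟨x, hx⟩ := hF c
    rw [← hx]
    exact v.valuation_le_one x
  isDVR := by
    rw [← HeightOneSpectrum.valuationSubringAtPrime_eq_valuationSubring]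
    exact IsLocalization.AtPrime.isDiscreteValuationRing_of_dedekind_domain B v.ne_bot _

namespace FFPlace
variable (hF : ∀ c : F, algebraMap F K c ∈ (algebraMap B K).range)

theorem val_toFFPlace (v : HeightOneSpectrum B) : (v.toFFPlace hF).val = v.valuation K :=
  val_eq_of_surjective _ (v.valuation_surjective K) fun _ => Iff.rfl

theorem toFFPlace_injective :
    Function.Injective (HeightOneSpectrum.toFFPlace hF) := by
  intro v w h
  apply HeightOneSpectrum.eq_of_valuation_isEquiv_valuation (K := K)
  rw [← val_toFFPlace hF, ← val_toFFPlace hF, h]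

theorem algebraMap_mem_toFFPlace (v : HeightOneSpectrum B) (x : B) :
    algebraMap B K x ∈ (v.toFFPlace hF).ring :=
  v.valuation_le_one x

/-- The prime is the center of `P` on `B`. It is nonzero, since otherwise every nonzero element of
`B` would be a unit at `P` and `P.ring` would be all of `K`. The localization of `B` at the center
lies in `P.ring`, and inclusion suffices. -/
theorem exists_eq_toFFPlace (P : FFPlace F K) (hP : ∀ x : B, algebraMap B K x ∈ P.ring) :
    ∃ v : HeightOneSpectrum B, v.toFFPlace hF = P := by
  let φ : B →+* P.ring := (algebraMap B K).codRestrict P.ring hP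
  let p : Ideal B := (IsLocalRing.maximalIdeal P.ring).comap φ
  have hp : ∀ x, x ∈ p ↔ P.val (algebraMap B K x) < 1 := fun x => (P.val_lt_one_iff (φ x)).symm
  have hp0 : p ≠ ⊥ := by
    intro h0
    apply P.ring_ne_top
    rw [eq_top_iff]
    rintro x -
    obtain ⟨a, b, hb, rfl⟩ := IsFractionRing.div_surjective (A := B) x
    have hb' : b ∉ p := by rw [h0]; exact nonZeroDivisors.ne_zero hb
    rw [hp, not_lt] at hb'
    rw [← val_le_one_iff, map_div₀]
    exact div_le_one_of_le₀ ((P.val_le_one_iff.2 (hP a)).trans hb') zero_le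
  refine ⟨⟨p, inferInstance, hp0⟩, eq_of_ring_le ?_⟩
  intro x hx
  obtain ⟨n, d, h⟩ := HeightOneSpectrum.exists_primeCompl_mul_eq_of_integer
    (⟨p, inferInstance, hp0⟩ : HeightOneSpectrum B) x hx
  have hd : (d : B) ∉ p := d.2
  rw [hp, not_lt] at hd
  rw [← val_le_one_iff]
  have h2 := congrArg P.val h
  rw [map_mul] at h2
  have h3 : P.val x * 1 ≤ 1 := calc
    _ ≤ P.val x * P.val (algebraMap B K d) := by gcongr
    _ ≤ 1 := by rw [h2]; exact P.val_le_one_iff.2 (hP n)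
  simpa using h3

end FFPlace
end

/-! ### Divisors and the class group of a Dedekind domain -/

section


section FractionalIdeals

variable {K B : Type*} [Field K] [CommRing B] [IsDedekindDomain B] [Algebra B K]
  [IsFractionRing B K]

theorem FractionalIdeal.eq_of_count_eq {I J : FractionalIdeal B⁰ K} (hI : I ≠ 0) (hJ : J ≠ 0)
    (h : ∀ v : HeightOneSpectrum B, count K v I = count K v J) : I = J := by
  rw [← finprod_heightOneSpectrum_factorization' K hI,
    ← finprod_heightOneSpectrum_factorization' K hJ]
  simp only [h]

theorem FractionalIdeal.count_spanSingleton (v : HeightOneSpectrum B) {x : K} (hx : x ≠ 0) :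
    count K v (spanSingleton B⁰ x) = -log (v.valuation K x) := by
  have key : ∀ b : B, b ≠ 0 → count K v (spanSingleton B⁰ (algebraMap B K b)) =
      -log (v.valuation K (algebraMap B K b)) := fun b hb => by
    classical
    rw [← coeIdeal_span_singleton, count_coe _ _ (by simpa using hb),
      HeightOneSpectrum.valuation_of_algebraMap, HeightOneSpectrum.intValuation_if_neg _ hb]
    simp
  obtain ⟨a, b, hb, rfl⟩ := IsFractionRing.div_surjective (A := B) x
  have hb := nonZeroDivisors.ne_zero hb
  have ha : a ≠ 0 := by rintro rfl; simp at hx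
  have ha' : algebraMap B K a ≠ 0 := by simpa using ha
  have hb' : algebraMap B K b ≠ 0 := by simpa using hb
  have h1 : spanSingleton B⁰ (algebraMap B K a) =
      spanSingleton B⁰ (algebraMap B K a / algebraMap B K b) *
        spanSingleton B⁰ (algebraMap B K b) := by
    rw [spanSingleton_mul_spanSingleton, div_mul_cancel₀ _ hb']
  have h2 := key a ha
  rw [h1, count_mul _ _ (spanSingleton_ne_zero_iff.2 hx) (spanSingleton_ne_zero_iff.2 hb'),
    key b hb] at h2
  rw [map_div₀, log_div (by simpa using ha) (by simpa using hb)]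
  linarith

/-- The fractional ideal `∏ v ^ D v`. -/
def FractionalIdeal.ofDivisor (D : HeightOneSpectrum B →₀ ℤ) : (FractionalIdeal B⁰ K)ˣ :=
  Units.mk0 (D.prod fun v n => (v.asIdeal : FractionalIdeal B⁰ K) ^ n) <| by
    rw [Finsupp.prod, Finset.prod_ne_zero_iff]
    exact fun v _ => zpow_ne_zero _ (coeIdeal_ne_zero.mpr v.ne_bot)

theorem FractionalIdeal.count_ofDivisor (D : HeightOneSpectrum B →₀ ℤ) (v : HeightOneSpectrum B) :
    count K v (ofDivisor D : (FractionalIdeal B⁰ K)ˣ) = D v :=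
  count_finsuppProd K v D

theorem FractionalIdeal.ofDivisor_eq_iff (D : HeightOneSpectrum B →₀ ℤ)
    (I : (FractionalIdeal B⁰ K)ˣ)  :
    ofDivisor D = I ↔ ∀ v, D v = count K v (I : FractionalIdeal B⁰ K) := by
  constructor
  · rintro rfl v
    rw [count_ofDivisor]
  · intro h
    ext1
    exact eq_of_count_eq (Units.ne_zero _) (Units.ne_zero _) fun v => by rw [count_ofDivisor, h]

theorem FractionalIdeal.ofDivisor_add (D E : HeightOneSpectrum B →₀ ℤ) :
    (ofDivisor (D + E) : (FractionalIdeal B⁰ K)ˣ) = ofDivisor D * ofDivisor E := by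
  rw [ofDivisor_eq_iff]
  intro v
  rw [Units.val_mul, count_mul _ _ (Units.ne_zero _) (Units.ne_zero _), count_ofDivisor,
    count_ofDivisor, Finsupp.add_apply]

variable (K) in
theorem ClassGroup.mk_surjective : Function.Surjective (ClassGroup.mk (R := B) K) := by
  intro c
  obtain ⟨I, rfl⟩ := ClassGroup.mk0_surjective c
  exact ⟨_, ClassGroup.mk_mk0 K I⟩

theorem ClassGroup.mk_ofDivisor_eq_one_iff (D : HeightOneSpectrum B →₀ ℤ) :
    ClassGroup.mk K (FractionalIdeal.ofDivisor D) = 1 ↔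
      ∃ x : Kˣ, ∀ v, D v = -log (v.valuation K (x : K)) := by
  rw [ClassGroup.mk_eq_one_iff]
  constructor
  · rintro ⟨x, hx⟩
    have hx' : ((FractionalIdeal.ofDivisor D : (FractionalIdeal B⁰ K)ˣ) : FractionalIdeal B⁰ K) =
        FractionalIdeal.spanSingleton B⁰ x := by
      apply Subtype.coe_injective
      simp only [FractionalIdeal.val_eq_coe, hx, FractionalIdeal.coe_spanSingleton]
    have hx0 : x ≠ 0 := by
      rintro rfl
      exact Units.ne_zero (FractionalIdeal.ofDivisor D : (FractionalIdeal B⁰ K)ˣ) (by simp [hx'])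
    refine ⟨Units.mk0 x hx0, fun v => ?_⟩
    rw [← FractionalIdeal.count_ofDivisor (K := K), hx', FractionalIdeal.count_spanSingleton _ hx0,
      Units.val_mk0]
  · rintro ⟨x, hx⟩
    have : FractionalIdeal.ofDivisor D = toPrincipalIdeal B K x := by
      rw [FractionalIdeal.ofDivisor_eq_iff]
      intro v
      rw [hx, coe_toPrincipalIdeal, FractionalIdeal.count_spanSingleton _ x.ne_zero]
    rw [this, coe_toPrincipalIdeal, FractionalIdeal.coe_spanSingleton]
    exact ⟨x, rfl⟩

end FractionalIdeals

section

variable {F K B : Type*} [Field F] [Field K] [Algebra F K] [CommRing B] [IsDedekindDomain B]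
  [Algebra B K] [IsFractionRing B K]
  (hF : ∀ c : F, algebraMap F K c ∈ (algebraMap B K).range)

/-- The map from divisors of `K` to the ideal class group of a Dedekind domain in `K`. -/
def FFDivisor.toClassGroup : FFDivisor F K →+ Additive (ClassGroup B) where
  toFun D := Additive.ofMul (ClassGroup.mk K (FractionalIdeal.ofDivisor
    (D.comapDomain (HeightOneSpectrum.toFFPlace hF) (FFPlace.toFFPlace_injective hF).injOn)))
  map_zero' := by
    rw [ofMul_eq_zero, ClassGroup.mk_ofDivisor_eq_one_iff]
    exact ⟨1, by simp⟩
  map_add' D E := by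
    rw [Finsupp.comapDomain_add_of_injective (FFPlace.toFFPlace_injective hF),
      FractionalIdeal.ofDivisor_add, map_mul, ofMul_mul]

/-- The condition is phrased through places rather than primes, so that divisors for different rings
`B` in the same field can be compared. -/
theorem FFDivisor.toClassGroup_eq_zero_iff (D : FFDivisor F K) :
    FFDivisor.toClassGroup hF D = 0 ↔
      ∃ x : Kˣ, ∀ P : FFPlace F K, (∀ b : B, algebraMap B K b ∈ P.ring) → D P = P.ord x := by
  refine Iff.trans (ofMul_eq_zero.trans (ClassGroup.mk_ofDivisor_eq_one_iff _)) ?_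
  refine exists_congr fun x => ⟨fun h P hP => ?_, fun h v => ?_⟩
  · obtain ⟨v, rfl⟩ := FFPlace.exists_eq_toFFPlace hF P hP
    rw [FFPlace.ord_eq, FFPlace.val_toFFPlace]
    exact h v
  · have := h _ (FFPlace.algebraMap_mem_toFFPlace hF v)
    rw [FFPlace.ord_eq, FFPlace.val_toFFPlace] at this
    exact this

theorem FFDivisor.toClassGroup_surjective :
    Function.Surjective (FFDivisor.toClassGroup (F := F) (K := K) (B := B) hF) := by
  intro c
  obtain ⟨I, hI⟩ := ClassGroup.mk_surjective K c.toMul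
  have hfin := Filter.eventually_cofinite.1
    (FractionalIdeal.finite_factors (I : FractionalIdeal B⁰ K))
  let E : HeightOneSpectrum B →₀ ℤ := Finsupp.onFinset hfin.toFinset
    (fun v => FractionalIdeal.count K v (I : FractionalIdeal B⁰ K)) (by simp)
  -- The exponents of the fractional ideal are extended by zero to the places that do not come from
  -- `B`.
  refine ⟨E.embDomain ⟨_, FFPlace.toFFPlace_injective hF⟩, ?_⟩
  have : Finsupp.comapDomain (HeightOneSpectrum.toFFPlace hF)
      (E.embDomain ⟨_, FFPlace.toFFPlace_injective hF⟩)
      (FFPlace.toFFPlace_injective hF).injOn = E := by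
    ext v
    rw [Finsupp.comapDomain_apply]
    exact Finsupp.embDomain_apply_self ⟨_, FFPlace.toFFPlace_injective hF⟩ E v
  change Additive.ofMul (ClassGroup.mk K (FractionalIdeal.ofDivisor (Finsupp.comapDomain _ _ _))) = c
  rw [this, (FractionalIdeal.ofDivisor_eq_iff E I).2 fun v => rfl, hI]
  rfl

end
end

/-! ### Degrees of divisors as dimensions of quotient rings -/

section


/-- Unique factorization reduces this to prime powers and to coprime ideals. Infinitude makes the
zero ideal have index zero, which covers the degenerate products. -/
theorem Submodule.cardQuot_mul_of_infinite {S : Type*} [CommRing S] [IsDedekindDomain S]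
    [Infinite S] (I J : Ideal S) : cardQuot (I * J) = cardQuot I * cardQuot J :=
  UniqueFactorizationMonoid.multiplicative_of_coprime cardQuot I J (cardQuot_bot _ _)
    (fun {I J} hI => by simp [Ideal.isUnit_iff.mp hI, Ideal.mul_top])
    (fun {I} i hI =>
      have : Ideal.IsPrime I := Ideal.isPrime_of_prime hI
      cardQuot_pow_of_prime hI.ne_zero)
    fun {I J} hIJ => cardQuot_mul_of_coprime <| Ideal.isCoprime_iff_sup_eq.mpr
      (Ideal.isUnit_iff.mp
        (hIJ (Ideal.dvd_iff_le.mpr le_sup_left) (Ideal.dvd_iff_le.mpr le_sup_right)))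

theorem Ideal.finrank_quotient_mul {F B : Type*} [Field F] [Finite F] [CommRing B]
    [IsDedekindDomain B] [Infinite B] [Algebra F B] [Ring.HasFiniteQuotients B] {I J : Ideal B}
    (hI : I ≠ ⊥) (hJ : J ≠ ⊥) : Module.finrank F (B ⧸ I * J) =
      Module.finrank F (B ⧸ I) + Module.finrank F (B ⧸ J) := by
  have hcard : ∀ {I : Ideal B}, I ≠ ⊥ →
      Submodule.cardQuot I = Nat.card F ^ Module.finrank F (B ⧸ I) := fun {I} hI => by
    have := Ring.HasFiniteQuotients.finiteQuotient hI
    rw [Submodule.cardQuot_apply]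
    exact Module.natCard_eq_pow_finrank
  have h := Submodule.cardQuot_mul_of_infinite I J
  rw [hcard hI, hcard hJ, hcard (by simpa using ⟨hI, hJ⟩), ← pow_add] at h
  exact Nat.pow_right_injective Finite.one_lt_card h

section

variable {F K B : Type*} [Field F] [Field K] [Algebra F K] [CommRing B] [IsDedekindDomain B]
  [Algebra B K] [IsFractionRing B K] [Algebra F B] [IsScalarTower F B K]

/-- The residue field of the localization is already `B` modulo the prime, because denominators
outside a maximal ideal are invertible modulo it. -/
theorem FFPlace.degree_toFFPlace
    (hF : ∀ c : F, algebraMap F K c ∈ (algebraMap B K).range) (v : HeightOneSpectrum B) :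
    (v.toFFPlace hF).degree = Module.finrank F (B ⧸ v.asIdeal) := by
  let P := v.toFFPlace hF
  let φ : B →ₐ[F] P.ring :=
    { (algebraMap B K).codRestrict P.ring (algebraMap_mem_toFFPlace hF v) with
      commutes' := fun c => Subtype.ext (IsScalarTower.algebraMap_apply F B K c).symm }
  let ψ : B →ₐ[F] IsLocalRing.ResidueField P.ring :=
    { (IsLocalRing.residue P.ring).comp φ.toRingHom with
      commutes' := fun c => congrArg (IsLocalRing.residue P.ring) (φ.commutes c) }
  have hker : RingHom.ker ψ = v.asIdeal := by
    ext x
    refine (IsLocalRing.residue_eq_zero_iff (φ x)).trans ?_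
    rw [← val_lt_one_iff, val_toFFPlace]
    exact v.valuation_lt_one_iff_mem x
  have hsurj : Function.Surjective ψ := by
    intro y
    obtain ⟨z, rfl⟩ := IsLocalRing.residue_surjective y
    obtain ⟨n, d, h⟩ := v.exists_primeCompl_mul_eq_of_integer (z : K) z.2
    obtain ⟨e, he⟩ : ∃ e, e * (d : B) - 1 ∈ v.asIdeal := by
      have := v.isMaximal
      obtain ⟨e, i, hi, hei⟩ := this.exists_inv d.2
      exact ⟨e, by rw [← hei]; simpa using hi⟩
    have h1 : ψ d * ψ e = 1 := by
      have he' : ψ (e * d - 1) = 0 := by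
        rw [← RingHom.mem_ker, hker]
        exact he
      rw [map_sub, map_mul, map_one, sub_eq_zero] at he'
      rw [mul_comm, he']
    have h2 : IsLocalRing.residue P.ring z * ψ d = ψ n := by
      have : z * φ d = φ n := Subtype.ext h
      exact (map_mul (IsLocalRing.residue P.ring) z (φ d)).symm.trans
        (congrArg (IsLocalRing.residue P.ring) this)
    exact ⟨n * e, by rw [map_mul, ← h2, mul_assoc, h1, mul_one]⟩
  have e := (Ideal.quotientKerAlgEquivOfSurjective hsurj).toLinearEquiv.finrank_eq
  rw [← hker]
  exact e.symm

/-- Induction on the prime factors of the ideal: a new prime adds one to its own coefficient and the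
dimension of its residue field to the degree. -/
theorem FFDivisor.exists_ofIdeal [Finite F] [Infinite B] [Ring.HasFiniteQuotients B]
    (hF : ∀ c : F, algebraMap F K c ∈ (algebraMap B K).range) {I : Ideal B} (hI : I ≠ 0) :
    ∃ D : FFDivisor F K, (∀ v : HeightOneSpectrum B,
        D (v.toFFPlace hF) = FractionalIdeal.count K v (I : FractionalIdeal B⁰ K)) ∧
      (∀ P : FFPlace F K, (∃ b : B, algebraMap B K b ∉ P.ring) → D P = 0) ∧
      FFDivisor.degree F K D = Module.finrank F (B ⧸ I) := by
  classical
  induction I using UniqueFactorizationMonoid.induction_on_prime with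
  | h₁ => exact absurd rfl hI
  | h₂ I h =>
    obtain rfl := Ideal.isUnit_iff.1 h
    refine ⟨0, fun v => ?_, fun P _ => rfl, ?_⟩
    · rw [FractionalIdeal.coeIdeal_top]
      simpa using (FractionalIdeal.count_one K v).symm
    · rw [map_zero, Module.finrank_zero_of_subsingleton]
      rfl
  | h₃ J p hJ hp ih =>
    obtain ⟨D, h1, h2, h3⟩ := ih hJ
    let w : HeightOneSpectrum B := ⟨p, Ideal.isPrime_of_prime hp, hp.ne_zero⟩
    refine ⟨D + Finsupp.single (w.toFFPlace hF) 1, fun v => ?_, fun P hP => ?_, ?_⟩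
    · rw [FractionalIdeal.coeIdeal_mul, FractionalIdeal.count_mul _ _
        (FractionalIdeal.coeIdeal_ne_zero.2 hp.ne_zero) (FractionalIdeal.coeIdeal_ne_zero.2 hJ),
        Finsupp.add_apply, h1, Finsupp.single_apply,
        (FFPlace.toFFPlace_injective hF).eq_iff, add_comm]
      congr 1
      exact (FractionalIdeal.count_maximal K v w).symm
    · obtain ⟨b, hb⟩ := hP
      have hne : w.toFFPlace hF ≠ P := by
        rintro rfl
        exact hb (FFPlace.algebraMap_mem_toFFPlace hF w b)
      rw [Finsupp.add_apply, h2 P ⟨b, hb⟩, Finsupp.single_eq_of_ne hne.symm, add_zero]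
    · rw [map_add, h3, Ideal.finrank_quotient_mul hp.ne_zero hJ, add_comm]
      simp [FFDivisor.degree, FFPlace.degree_toFFPlace, w]

/-- The finite part of the divisor of a nonzero element of `B`. -/
theorem FFDivisor.exists_ofElement [Finite F] [Infinite B] [Ring.HasFiniteQuotients B]
    (hF : ∀ c : F, algebraMap F K c ∈ (algebraMap B K).range) {z : B} (hz : z ≠ 0) :
    ∃ D : FFDivisor F K, (∀ P : FFPlace F K, (∀ b : B, algebraMap B K b ∈ P.ring) →
        D P = -log (P.val (algebraMap B K z))) ∧
      (∀ P : FFPlace F K, (∃ b : B, algebraMap B K b ∉ P.ring) → D P = 0) ∧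
      FFDivisor.degree F K D = Module.finrank F (B ⧸ Ideal.span {z}) := by
  obtain ⟨D, h1, h2, h3⟩ := FFDivisor.exists_ofIdeal (F := F) (K := K) hF (I := Ideal.span {z})
    (by simpa using hz)
  refine ⟨D, fun P hP => ?_, h2, h3⟩
  obtain ⟨v, rfl⟩ := FFPlace.exists_eq_toFFPlace hF P hP
  rw [h1, FFPlace.val_toFFPlace, FractionalIdeal.coeIdeal_span_singleton,
    FractionalIdeal.count_spanSingleton _ (by simpa using hz)]

end

theorem Polynomial.hasFiniteQuotients (F : Type*) [Field F] [Finite F] :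
    Ring.HasFiniteQuotients F[X] where
  finiteQuotient {I} hI := by
    obtain ⟨p, rfl⟩ := Submodule.IsPrincipal.principal I
    have hp : p ≠ 0 := by rintro rfl; simp at hI
    have : Module.Finite F (AdjoinRoot p) := (AdjoinRoot.powerBasis hp).finite
    exact Module.finite_of_finite F (M := AdjoinRoot p)
end

/-! ### Places over infinity and approximation of the small root -/

section


namespace FFPlace

section Conjugate

variable {F K : Type*} [Field F] [Field K] [Algebra F K]

/-- The image of a place under an automorphism of `K`. -/
def comap (P : FFPlace F K) (σ : K ≃ₐ[F] K) : FFPlace F K where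
  ring := P.ring.comap (σ : K →+* K)
  algebraMap_mem c := by
    rw [ValuationSubring.mem_comap]
    simpa using P.algebraMap_mem c
  isDVR := by
    let e : P.ring ≃+* P.ring.comap (σ : K →+* K) :=
      { toFun := fun x => ⟨σ.symm x, by simp [ValuationSubring.mem_comap]⟩
        invFun := fun x => ⟨σ x, x.2⟩
        left_inv := fun x => by simp
        right_inv := fun x => by simp
        map_mul' := fun x y => by ext; simp
        map_add' := fun x y => by ext; simp }
    exact IsDiscreteValuationRing.RingEquivClass.isDiscreteValuationRing e

theorem val_comap (P : FFPlace F K) (σ : K ≃ₐ[F] K) (x : K) : (P.comap σ).val x = P.val (σ x) := by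
  have : (P.comap σ).val = P.val.comap (σ : K →+* K) := by
    refine val_eq_of_surjective _ (P.val_surjective.comp σ.surjective) fun x => ?_
    exact P.val_le_one_iff
  rw [this]
  rfl

end Conjugate

variable {F K : Type*} [Field F] [Field K] [Algebra F K] [Algebra F[X] K]
  [IsScalarTower F F[X] K]

/-- A place is infinite if it is a pole of `T`. -/
def IsInfinite (P : FFPlace F K) : Prop := 1 < P.val (algebraMap F[X] K Polynomial.X)

/-- At a pole of `T` the leading term strictly dominates all others. -/
theorem IsInfinite.val_polynomial {P : FFPlace F K} (hP : P.IsInfinite) {p : F[X]} (hp : p ≠ 0) :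
    P.val (algebraMap F[X] K p) = P.val (algebraMap F[X] K Polynomial.X) ^ p.natDegree := by
  induction hn : p.natDegree using Nat.strong_induction_on generalizing p with
  | _ n ih =>
    subst hn
    have hlead : P.val (algebraMap F[X] K (Polynomial.monomial p.natDegree p.leadingCoeff)) =
        P.val (algebraMap F[X] K Polynomial.X) ^ p.natDegree := by
      rw [← Polynomial.C_mul_X_pow_eq_monomial, map_mul, map_mul, map_pow, map_pow,
        ← Polynomial.algebraMap_eq, ← IsScalarTower.algebraMap_apply F F[X] K,
        P.val_algebraMap (by simpa using hp), one_mul]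
    by_cases h0 : p.eraseLead = 0
    · rw [← hlead]
      conv_lhs => rw [← p.eraseLead_add_monomial_natDegree_leadingCoeff, h0, zero_add]
    · have hlt : p.eraseLead.natDegree < p.natDegree :=
        p.eraseLead_natDegree_lt_or_eraseLead_eq_zero.resolve_right h0
      rw [← hlead]
      conv_lhs => rw [← p.eraseLead_add_monomial_natDegree_leadingCoeff, map_add]
      refine Valuation.map_add_eq_of_lt_right P.val ?_
      rw [hlead, ih _ hlt h0 rfl]
      exact pow_lt_pow_right₀ hP hlt

section RatFunc

variable [Algebra (RatFunc F) K] [IsScalarTower F[X] (RatFunc F) K]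

theorem IsInfinite.val_ratFunc {P : FFPlace F K} (hP : P.IsInfinite) {r : RatFunc F} (hr : r ≠ 0) :
    P.val (algebraMap (RatFunc F) K r) = P.val (algebraMap F[X] K Polynomial.X) ^ r.intDegree := by
  have h0 : P.val (algebraMap F[X] K Polynomial.X) ≠ 0 := (zero_le.trans_lt hP).ne'
  conv_lhs => rw [← r.num_div_denom]
  rw [map_div₀, map_div₀, ← IsScalarTower.algebraMap_apply, ← IsScalarTower.algebraMap_apply,
    hP.val_polynomial (RatFunc.num_ne_zero hr), hP.val_polynomial r.denom_ne_zero,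
    RatFunc.intDegree, zpow_sub₀ h0, zpow_natCast, zpow_natCast]

end RatFunc

/-- The approximants to the root `f` of `X² - aX - b` of absolute value less than one. -/
def rootApprox (a : F[X]) (b : F) : ℕ → RatFunc F
  | 0 => 0
  | n + 1 => -algebraMap F (RatFunc F) b / (algebraMap F[X] (RatFunc F) a - rootApprox a b n)

variable {a : F[X]} {b : F} {f : K}

theorem IsInfinite.one_lt_val_polynomial {P : FFPlace F K} (hP : P.IsInfinite)
    (ha : 0 < a.natDegree) : 1 < P.val (algebraMap F[X] K a) := by
  rw [hP.val_polynomial (by rintro rfl; simp at ha)]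
  exact one_lt_pow₀ hP ha.ne'

theorem IsInfinite.val_root {P : FFPlace F K} (hP : P.IsInfinite) (ha : 0 < a.natDegree)
    (hb : b ≠ 0) (hf : f * (algebraMap F[X] K a - f) = -algebraMap F K b) (hfP : P.val f < 1) :
    P.val f * P.val (algebraMap F[X] K a) = 1 := by
  have h1 := congrArg P.val hf
  rw [map_mul, Valuation.map_neg, P.val_algebraMap hb,
    Valuation.map_sub_eq_of_lt_left P.val (hfP.trans (hP.one_lt_val_polynomial ha))] at h1
  exact h1

/-- If neither root were small, their product having value one would force both to have value at
most one, hence also their sum `a`, which has a pole. -/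
theorem IsInfinite.val_root_lt_one_or {P : FFPlace F K} (hP : P.IsInfinite) (ha : 0 < a.natDegree)
    (hb : b ≠ 0) (hf : f * (algebraMap F[X] K a - f) = -algebraMap F K b) :
    P.val f < 1 ∨ P.val (algebraMap F[X] K a - f) < 1 := by
  by_contra! h
  have h1 := congrArg P.val hf
  rw [map_mul, Valuation.map_neg, P.val_algebraMap hb] at h1
  have h2 : P.val f ≤ 1 := by
    rw [← h1]
    exact le_mul_of_one_le_right' h.2
  have h3 : P.val (algebraMap F[X] K a - f) ≤ 1 := by
    rw [← h1]
    exact le_mul_of_one_le_left' h.1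
  have h4 := Valuation.map_add_le P.val h3 h2
  rw [sub_add_cancel] at h4
  exact (hP.one_lt_val_polynomial ha).not_ge h4

variable [Algebra (RatFunc F) K] [IsScalarTower F[X] (RatFunc F) K] [IsScalarTower F (RatFunc F) K]

/-- The root is a fixed point of `c ↦ -b / (a - c)`, which contracts distances on the open unit ball
by the square of the value of `a`. Only one of these two factors is needed for the stated rate. -/
theorem IsInfinite.val_sub_rootApprox_le {P : FFPlace F K} (hP : P.IsInfinite)
    (ha : 0 < a.natDegree) (hb : b ≠ 0)
    (hf : f * (algebraMap F[X] K a - f) = -algebraMap F K b) (hfP : P.val f < 1) (n : ℕ) :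
    P.val (algebraMap (RatFunc F) K (rootApprox a b n)) < 1 ∧
      P.val (f - algebraMap (RatFunc F) K (rootApprox a b n)) ≤ exp (-n : ℤ) := by
  have ha1 := hP.one_lt_val_polynomial (K := K) ha
  induction n with
  | zero => simpa [rootApprox] using hfP.le
  | succ n ih =>
    obtain ⟨h1, h2⟩ := ih
    set c := algebraMap (RatFunc F) K (rootApprox a b n) with hc
    have hc' : algebraMap (RatFunc F) K (rootApprox a b (n + 1)) =
        -algebraMap F K b / (algebraMap F[X] K a - c) := by
      rw [rootApprox, map_div₀, map_neg, map_sub, ← IsScalarTower.algebraMap_apply,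
        ← IsScalarTower.algebraMap_apply]
    have hv1 : P.val (algebraMap F[X] K a - c) = P.val (algebraMap F[X] K a) :=
      Valuation.map_sub_eq_of_lt_left _ (h1.trans ha1)
    have hv2 : P.val (algebraMap F[X] K a - f) = P.val (algebraMap F[X] K a) :=
      Valuation.map_sub_eq_of_lt_left _ (hfP.trans ha1)
    have hn1 : algebraMap F[X] K a - c ≠ 0 := by
      intro h
      rw [h, map_zero] at hv1
      exact (zero_le.trans_lt ha1).ne hv1
    have hn2 : algebraMap F[X] K a - f ≠ 0 := by
      intro h
      rw [h, map_zero] at hv2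
      exact (zero_le.trans_lt ha1).ne hv2
    rw [hc']
    constructor
    · rw [map_div₀, Valuation.map_neg, P.val_algebraMap hb, hv1, one_div]
      exact inv_lt_one_of_one_lt₀ ha1
    · have : f - -algebraMap F K b / (algebraMap F[X] K a - c) =
          -algebraMap F K b * (f - c) /
            ((algebraMap F[X] K a - f) * (algebraMap F[X] K a - c)) := by
        rw [← hf]
        field_simp
        ring
      have ha0 : P.val (algebraMap F[X] K a) ≠ 0 := (zero_le.trans_lt ha1).ne'
      have ha2 : exp 1 ≤ P.val (algebraMap F[X] K a) := by
        rw [← exp_log ha0, ← exp_zero, exp_lt_exp] at ha1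
        rw [← exp_log ha0, exp_le_exp]
        omega
      rw [this, map_div₀, map_mul, map_mul, Valuation.map_neg, P.val_algebraMap hb, hv1, hv2,
        one_mul]
      calc P.val (f - c) / (P.val (algebraMap F[X] K a) * P.val (algebraMap F[X] K a))
          ≤ exp (-n : ℤ) / (exp 1 * 1) :=
            div_le_div₀ zero_le h2 (by simp) (mul_le_mul' ha2 ha1.le)
        _ = exp (-(n + 1 : ℕ) : ℤ) := by
            rw [mul_one, ← exp_sub]
            congr 1
            push_cast
            ring

/-- The sequence is chosen before the place. This uniformity lets `eq_of_val_root_lt_one` use the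
same rational function at two places. -/
theorem IsInfinite.exists_approx (ha : 0 < a.natDegree) (hb : b ≠ 0)
    (hf : f * (algebraMap F[X] K a - f) = -algebraMap F K b)
    (hK : ∀ z : K, ∃ x y : RatFunc F, z = algebraMap _ K x + algebraMap _ K y * f) (z : K) :
    ∃ w : ℕ → RatFunc F, ∀ P : FFPlace F K, P.IsInfinite → P.val f < 1 → ∀ m : ℤ,
      ∀ᶠ n in Filter.atTop, P.val (z - algebraMap _ K (w n)) < exp m := by
  obtain ⟨x, y, rfl⟩ := hK z
  refine ⟨fun n => x + y * rootApprox a b n, fun P hP hfP m => ?_⟩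
  filter_upwards [Filter.eventually_gt_atTop (log (P.val (algebraMap _ K y)) - m).toNat] with n hn
  have h1 := (hP.val_sub_rootApprox_le ha hb hf hfP n).2
  have h2 : algebraMap _ K x + algebraMap _ K y * f -
      algebraMap (RatFunc F) K (x + y * rootApprox a b n) =
      algebraMap _ K y * (f - algebraMap (RatFunc F) K (rootApprox a b n)) := by
    rw [map_add, map_mul]
    ring
  rw [h2, map_mul]
  by_cases hy : P.val (algebraMap _ K y) = 0
  · rw [hy, zero_mul]
    simp
  · refine (mul_le_mul' le_rfl h1).trans_lt ?_
    rw [← exp_log hy, ← exp_add, exp_lt_exp]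
    omega

/-- The place over infinity at which the root `f` is small is unramified over `k`. -/
theorem IsInfinite.val_X {P : FFPlace F K} (hP : P.IsInfinite) (ha : 0 < a.natDegree) (hb : b ≠ 0)
    (hf : f * (algebraMap F[X] K a - f) = -algebraMap F K b)
    (hK : ∀ z : K, ∃ x y : RatFunc F, z = algebraMap _ K x + algebraMap _ K y * f)
    (hfP : P.val f < 1) : P.val (algebraMap F[X] K Polynomial.X) = exp 1 := by
  -- A rational function close enough to a uniformizer is itself a uniformizer. Its value is a power
  -- of that of `T`, so the logarithm of the latter divides one.
  obtain ⟨z, hz⟩ := P.val_surjective (exp (-1))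
  obtain ⟨w, hw⟩ := exists_approx ha hb hf hK z
  obtain ⟨n, hn⟩ := (hw P hP hfP (-1)).exists
  have h1 : P.val (algebraMap _ K (w n)) = exp (-1) := by
    rw [← hz, ← Valuation.map_sub_eq_of_lt_left P.val (hn.trans_eq hz.symm), sub_sub_cancel]
  have hw0 : w n ≠ 0 := by
    intro h
    rw [h, map_zero, map_zero] at h1
    exact exp_ne_zero h1.symm
  have h0 : P.val (algebraMap F[X] K Polynomial.X) ≠ 0 := (zero_le.trans_lt hP).ne'
  have hP' : 1 < P.val (algebraMap F[X] K Polynomial.X) := hP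
  rw [hP.val_ratFunc hw0, ← exp_log h0, ← exp_zsmul, exp_inj, smul_eq_mul] at h1
  rw [← exp_log h0, ← exp_zero, exp_lt_exp] at hP'
  have h4 : log (P.val (algebraMap F[X] K Polynomial.X)) ∣ 1 := ⟨-(w n).intDegree, by linarith⟩
  rw [← exp_log h0]
  congr 1
  exact Int.eq_one_of_dvd_one hP'.le h4

/-- At both places the value of `z` is read off from the degree of one common rational approximant,
so the valuation rings agree. -/
theorem IsInfinite.eq_of_val_root_lt_one {P Q : FFPlace F K} (hP : P.IsInfinite)
    (hQ : Q.IsInfinite) (ha : 0 < a.natDegree) (hb : b ≠ 0)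
    (hf : f * (algebraMap F[X] K a - f) = -algebraMap F K b)
    (hK : ∀ z : K, ∃ x y : RatFunc F, z = algebraMap _ K x + algebraMap _ K y * f)
    (hfP : P.val f < 1) (hfQ : Q.val f < 1) : P = Q := by
  refine eq_of_ring_le fun z hz => ?_
  by_cases hz0 : z = 0
  · rw [hz0]
    exact Q.ring.zero_mem
  obtain ⟨w, hw⟩ := exists_approx ha hb hf hK z
  obtain ⟨n, hn1, hn2⟩ := ((hw P hP hfP (log (P.val z))).and (hw Q hQ hfQ (log (Q.val z)))).exists
  have key : ∀ R : FFPlace F K, R.IsInfinite → R.val f < 1 →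
      R.val (z - algebraMap _ K (w n)) < exp (log (R.val z)) →
      R.val z = exp (w n).intDegree := by
    intro R hR hfR h
    have hRz : R.val z ≠ 0 := by simpa using hz0
    rw [exp_log hRz] at h
    have h1 : R.val (algebraMap _ K (w n)) = R.val z := by
      rw [← Valuation.map_sub_eq_of_lt_left R.val h, sub_sub_cancel]
    have hw0 : w n ≠ 0 := by
      intro h
      rw [h, map_zero, map_zero] at h1
      exact hRz h1.symm
    rw [← h1, hR.val_ratFunc hw0, hR.val_X ha hb hf hK hfR, ← exp_zsmul, smul_eq_mul, mul_one]
  rw [← val_le_one_iff] at hz ⊢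
  rwa [key Q hQ hfQ hn2, ← key P hP hfP hn1]

/-- Every residue class is represented by a rational function of degree at most zero, and such a
function is congruent to its constant value at infinity. -/
theorem IsInfinite.degree_eq_one {P : FFPlace F K} (hP : P.IsInfinite) (ha : 0 < a.natDegree)
    (hb : b ≠ 0) (hf : f * (algebraMap F[X] K a - f) = -algebraMap F K b)
    (hK : ∀ z : K, ∃ x y : RatFunc F, z = algebraMap _ K x + algebraMap _ K y * f)
    (hfP : P.val f < 1) : P.degree = 1 := by
  have hconst : ∀ z ∈ P.ring, ∃ c : F, P.val (z - algebraMap F K c) < 1 := by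
    intro z hz
    obtain ⟨w, hw⟩ := exists_approx ha hb hf hK z
    obtain ⟨n, hn⟩ := (hw P hP hfP 0).exists
    rw [exp_zero] at hn
    suffices h : ∃ c : F, P.val (algebraMap (RatFunc F) K (w n) - algebraMap F K c) < 1 by
      obtain ⟨c, hc⟩ := h
      refine ⟨c, ?_⟩
      rw [← sub_add_sub_cancel z (algebraMap (RatFunc F) K (w n)) (algebraMap F K c)]
      exact Valuation.map_add_lt _ hn hc
    have h1 : P.val (algebraMap (RatFunc F) K (w n)) ≤ 1 := by
      rw [← sub_sub_cancel z (algebraMap (RatFunc F) K (w n))]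
      exact (Valuation.map_sub_le P.val (P.val_le_one_iff.2 hz) hn.le)
    by_cases h0 : w n = 0
    · exact ⟨0, by simp [h0]⟩
    have hX := hP.val_X ha hb hf hK hfP
    rw [hP.val_ratFunc h0, hX, ← exp_zsmul, smul_eq_mul, mul_one, ← exp_zero, exp_le_exp] at h1
    set p := (w n).num with hp
    set q := (w n).denom with hq
    have hp0 : p ≠ 0 := RatFunc.num_ne_zero h0
    have hq0 : q ≠ 0 := (w n).denom_ne_zero
    have hqK : algebraMap F[X] K q ≠ 0 := by
      intro h
      have := hP.val_polynomial hq0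
      rw [h, map_zero, hX] at this
      exact pow_ne_zero _ exp_ne_zero this.symm
    have hwn : algebraMap (RatFunc F) K (w n) = algebraMap F[X] K p / algebraMap F[X] K q := by
      conv_lhs => rw [← (w n).num_div_denom]
      rw [map_div₀, ← IsScalarTower.algebraMap_apply, ← IsScalarTower.algebraMap_apply]
    have hdeg : p.natDegree ≤ q.natDegree := by
      rw [RatFunc.intDegree, ← hp, ← hq] at h1
      omega
    obtain ⟨c, hc⟩ : ∃ c : F, p - Polynomial.C c * q = 0 ∨
        (p - Polynomial.C c * q).natDegree < q.natDegree := by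
      -- Taking the coefficient of `p` at the degree of `q`, rather than its leading coefficient,
      -- gives the correct constant zero when `p` has smaller degree.
      refine ⟨p.coeff q.natDegree / q.leadingCoeff, ?_⟩
      by_contra! h
      have h2 : (p - Polynomial.C (p.coeff q.natDegree / q.leadingCoeff) * q).natDegree ≤
          q.natDegree :=
        (Polynomial.natDegree_sub_le_of_le hdeg (Polynomial.natDegree_C_mul_le _ _)).trans
          (max_self _).le
      have h3 := le_antisymm h2 h.2
      have h4 := Polynomial.leadingCoeff_ne_zero.2 h.1
      rw [Polynomial.leadingCoeff, h3, Polynomial.coeff_sub, Polynomial.coeff_C_mul,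
        Polynomial.coeff_natDegree, div_mul_cancel₀ _ (Polynomial.leadingCoeff_ne_zero.2 hq0),
        sub_self] at h4
      exact h4 rfl
    refine ⟨c, ?_⟩
    have h5 : algebraMap (RatFunc F) K (w n) - algebraMap F K c =
        algebraMap F[X] K (p - Polynomial.C c * q) / algebraMap F[X] K q := by
      rw [hwn, map_sub, map_mul, ← Polynomial.algebraMap_eq,
        ← IsScalarTower.algebraMap_apply F F[X] K]
      field_simp
    rw [h5]
    rcases hc with hc | hc
    · rw [hc]
      simp
    by_cases hpc : p - Polynomial.C c * q = 0
    · rw [hpc]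
      simp
    rw [map_div₀, hP.val_polynomial hpc, hP.val_polynomial hq0,
      div_lt_one₀ (pow_pos (zero_lt_one.trans hP) _)]
    exact pow_lt_pow_right₀ hP hc
  have hsurj : Function.Surjective (algebraMap F (IsLocalRing.ResidueField P.ring)) := by
    intro y
    obtain ⟨z, rfl⟩ := IsLocalRing.residue_surjective y
    obtain ⟨c, hc⟩ := hconst z z.2
    refine ⟨c, ?_⟩
    change IsLocalRing.residue P.ring (algebraMap F P.ring c) = _
    rw [← sub_eq_zero, ← map_sub, IsLocalRing.residue_eq_zero_iff, ← val_lt_one_iff,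
      Valuation.map_sub_swap] at *
    exact hc
  have e : F ≃ₗ[F] IsLocalRing.ResidueField P.ring :=
    LinearEquiv.ofBijective (Algebra.linearMap F _) ⟨(algebraMap F _).injective, hsurj⟩
  rw [degree, ← e.finrank_eq, Module.finrank_self]

end FFPlace
end

/-! ### The quadratic extension, its two infinite places, and degrees of principal divisors -/

section


theorem FFPlace.mem_of_isIntegral {F K R : Type*} [Field F] [Field K] [Algebra F K] [CommRing R]
    [Algebra R K] (P : FFPlace F K) (hR : ∀ r : R, algebraMap R K r ∈ P.ring) {x : K}
    (hx : IsIntegral R x) : x ∈ P.ring := by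
  obtain ⟨p, hp, hpx⟩ := hx
  have h : IsIntegral P.ring x := ⟨p.map ((algebraMap R K).codRestrict P.ring hR), hp.map _, by
    rw [Polynomial.eval₂_map]
    exact hpx⟩
  obtain ⟨y, rfl⟩ := IsIntegrallyClosed.isIntegral_iff.1 h
  exact y.2

theorem IsDiscreteValuationRing.hasFiniteQuotients (R : Type*) [CommRing R] [IsDomain R]
    [IsDiscreteValuationRing R] [Finite (IsLocalRing.ResidueField R)] :
    Ring.HasFiniteQuotients R where
  finiteQuotient {I} hI := by
    obtain ⟨ϖ, hϖ⟩ := IsDiscreteValuationRing.exists_irreducible R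
    obtain ⟨n, rfl⟩ := IsDiscreteValuationRing.ideal_eq_span_pow_irreducible hI hϖ
    rw [← Ideal.span_singleton_pow, ← hϖ.maximalIdeal_eq]
    apply Nat.finite_of_card_ne_zero
    have : Finite (R ⧸ IsLocalRing.maximalIdeal R) := ‹Finite (IsLocalRing.ResidueField R)›
    rw [← Submodule.cardQuot_apply, cardQuot_pow_of_prime (IsDiscreteValuationRing.not_a_field R),
      Submodule.cardQuot_apply]
    exact pow_ne_zero _ Nat.card_pos.ne'

/-- `K = k(f)` is a quadratic extension of `k = F(T)`, where `f (a - f) = -b`, with conjugation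
`σ`. -/
structure IsQuadraticUnitExtension {F K : Type*} [Field F] [Field K] [Algebra F K] [Algebra F[X] K]
    [Algebra (RatFunc F) K] (a : F[X]) (b : F) (f : K) (σ : K ≃ₐ[F] K) : Prop where
  natDegree_pos : 0 < a.natDegree
  ne_zero : b ≠ 0
  mul_conj : f * (algebraMap F[X] K a - f) = -algebraMap F K b
  exists_eq : ∀ z : K, ∃ x y : RatFunc F, z = algebraMap _ K x + algebraMap _ K y * f
  conj_root : σ f = algebraMap F[X] K a - f
  conj_polynomial : ∀ p : F[X], σ (algebraMap F[X] K p) = algebraMap F[X] K p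
  norm_eq : ∀ z : K, algebraMap (RatFunc F) K (Algebra.norm (RatFunc F) z) = z * σ z

namespace IsQuadraticUnitExtension

variable {F K : Type*} [Field F] [Field K] [Algebra F K] [Algebra F[X] K]
    [Algebra (RatFunc F) K] {a : F[X]} {b : F} {f : K} {σ : K ≃ₐ[F] K}

theorem conj_conj_root (h : IsQuadraticUnitExtension a b f σ) :
    σ (algebraMap F[X] K a - f) = f := by
  rw [map_sub, h.conj_polynomial, h.conj_root, sub_sub_cancel]

/-- The roles of the two roots can be interchanged. -/
theorem symm [IsScalarTower F[X] (RatFunc F) K] (h : IsQuadraticUnitExtension a b f σ) :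
    IsQuadraticUnitExtension a b (algebraMap F[X] K a - f) σ where
  natDegree_pos := h.natDegree_pos
  ne_zero := h.ne_zero
  mul_conj := by rw [sub_sub_cancel, mul_comm, h.mul_conj]
  exists_eq z := by
    obtain ⟨x, y, rfl⟩ := h.exists_eq z
    refine ⟨x + y * algebraMap F[X] (RatFunc F) a, -y, ?_⟩
    rw [map_add, map_mul, map_neg, ← IsScalarTower.algebraMap_apply]
    ring
  conj_root := by rw [h.conj_conj_root, sub_sub_cancel]
  conj_polynomial := h.conj_polynomial
  norm_eq := h.norm_eq

theorem root_ne_zero (h : IsQuadraticUnitExtension a b f σ) : f ≠ 0 := by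
  rintro rfl
  have := h.mul_conj
  rw [zero_mul, eq_comm, neg_eq_zero, map_eq_zero] at this
  exact h.ne_zero this

theorem isInfinite_comap (h : IsQuadraticUnitExtension a b f σ) {P : FFPlace F K}
    (hP : P.IsInfinite) : (P.comap σ).IsInfinite := by
  rw [FFPlace.IsInfinite, FFPlace.val_comap, h.conj_polynomial]
  exact hP

theorem val_comap_conj_root_lt_one (h : IsQuadraticUnitExtension a b f σ) {P : FFPlace F K}
    (hf : P.val f < 1) : (P.comap σ).val (algebraMap F[X] K a - f) < 1 := by
  rwa [FFPlace.val_comap, h.conj_conj_root]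

variable [IsScalarTower F F[X] K]

theorem one_lt_val_conj_root (h : IsQuadraticUnitExtension a b f σ) {P : FFPlace F K}
    (hP : P.IsInfinite) (hf : P.val f < 1) : 1 < P.val (algebraMap F[X] K a - f) := by
  have h1 := hP.one_lt_val_polynomial h.natDegree_pos
  rwa [Valuation.map_sub_eq_of_lt_left P.val (hf.trans h1)]

theorem ne_comap (h : IsQuadraticUnitExtension a b f σ) {P : FFPlace F K}
    (hP : P.IsInfinite) (hf : P.val f < 1) : P ≠ P.comap σ := by
  intro h1
  have h2 := h.val_comap_conj_root_lt_one hf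
  rw [← h1] at h2
  exact (h.one_lt_val_conj_root hP hf).not_gt h2

variable [IsScalarTower F[X] (RatFunc F) K] [IsScalarTower F (RatFunc F) K]

/-- One of the two roots is small at `Q`. Uniqueness of the place where that root is small, applied
to `f` or to `a - f`, decides the case. -/
theorem eq_or_eq_comap (h : IsQuadraticUnitExtension a b f σ) {P Q : FFPlace F K}
    (hP : P.IsInfinite) (hf : P.val f < 1) (hQ : Q.IsInfinite) : Q = P ∨ Q = P.comap σ := by
  rcases hQ.val_root_lt_one_or h.natDegree_pos h.ne_zero h.mul_conj with h1 | h1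
  · exact Or.inl (hQ.eq_of_val_root_lt_one hP h.natDegree_pos h.ne_zero h.mul_conj h.exists_eq h1 hf)
  · exact Or.inr (hQ.eq_of_val_root_lt_one (h.isInfinite_comap hP) h.natDegree_pos h.ne_zero
      h.symm.mul_conj h.symm.exists_eq h1 (h.val_comap_conj_root_lt_one hf))

theorem degree_eq_one (h : IsQuadraticUnitExtension a b f σ) {P : FFPlace F K}
    (hP : P.IsInfinite) (hf : P.val f < 1) : P.degree = 1 :=
  hP.degree_eq_one h.natDegree_pos h.ne_zero h.mul_conj h.exists_eq hf

theorem degree_comap_eq_one (h : IsQuadraticUnitExtension a b f σ) {P : FFPlace F K}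
    (hP : P.IsInfinite) (hf : P.val f < 1) : (P.comap σ).degree = 1 :=
  h.symm.degree_eq_one (h.isInfinite_comap hP) (h.val_comap_conj_root_lt_one hf)

theorem val_root (h : IsQuadraticUnitExtension a b f σ) {P : FFPlace F K}
    (hP : P.IsInfinite) (hf : P.val f < 1) : P.val f = exp (-a.natDegree : ℤ) := by
  have h1 := hP.val_root h.natDegree_pos h.ne_zero h.mul_conj hf
  have h2 : a ≠ 0 := by
    rintro rfl
    simpa using h.natDegree_pos
  rw [hP.val_polynomial h2, hP.val_X h.natDegree_pos h.ne_zero h.mul_conj h.exists_eq hf,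
    ← exp_nsmul] at h1
  rw [eq_inv_of_mul_eq_one_left h1, ← exp_neg]
  simp

/-- This computes the infinite part of the degree of a principal divisor: the product is the value
at `P` of the norm, a rational function, and `T` has value `exp 1` there. -/
theorem val_mul_val_comap (h : IsQuadraticUnitExtension a b f σ) {P : FFPlace F K}
    (hP : P.IsInfinite) (hf : P.val f < 1) {z : K} (hz : z ≠ 0) :
    P.val z * (P.comap σ).val z = exp (Algebra.norm (RatFunc F) z).intDegree := by
  have h0 : Algebra.norm (RatFunc F) z ≠ 0 := by
    intro h0
    have := h.norm_eq z
    rw [h0, map_zero, eq_comm, mul_eq_zero, map_eq_zero] at this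
    exact hz (this.elim id id)
  rw [FFPlace.val_comap, ← map_mul, ← h.norm_eq, hP.val_ratFunc h0,
    hP.val_X h.natDegree_pos h.ne_zero h.mul_conj h.exists_eq hf, ← exp_zsmul, smul_eq_mul, mul_one]

theorem log_val_root (h : IsQuadraticUnitExtension a b f σ) {P : FFPlace F K}
    (hP : P.IsInfinite) (hf : P.val f < 1) :
    log (P.val f) = -a.natDegree ∧ log ((P.comap σ).val f) = a.natDegree := by
  have h1 := h.val_root hP hf
  have h2 := h.symm.val_root (h.isInfinite_comap hP) (h.val_comap_conj_root_lt_one hf)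
  have h3 := congrArg (P.comap σ).val h.mul_conj
  rw [map_mul, Valuation.map_neg, FFPlace.val_algebraMap _ h.ne_zero, h2] at h3
  rw [h1, log_exp, eq_inv_of_mul_eq_one_left h3, ← exp_neg, log_exp, neg_neg]
  exact ⟨rfl, rfl⟩

end IsQuadraticUnitExtension

section RingOfIntegers

open FunctionField

variable {F K : Type*} [Field F] [Field K] [Algebra F[X] K]

section Norm

variable [Algebra (RatFunc F) K] [IsScalarTower F[X] (RatFunc F) K] [FunctionField F K]
  [Algebra.IsSeparable (RatFunc F) K]

theorem FunctionField.ringOfIntegers.natDegree_norm (z : ringOfIntegers F K) :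
    ((Algebra.norm F[X] z).natDegree : ℤ) =
      (Algebra.norm (RatFunc F) (algebraMap _ K z)).intDegree := by
  have : Module.Free F[X] (ringOfIntegers F K) :=
    have : Module.IsTorsionFree F[X] K := .trans_faithfulSMul F[X] (RatFunc F) K
    IsIntegralClosure.module_free F[X] (RatFunc F) K _
  have := IsIntegralClosure.isLocalization F[X] (RatFunc F) K (ringOfIntegers F K)
  rw [Algebra.norm_localization F[X] F[X]⁰, RatFunc.intDegree_polynomial]

instance FunctionField.ringOfIntegers.hasFiniteQuotients [Finite F] :
    Ring.HasFiniteQuotients (ringOfIntegers F K) :=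
  have := Polynomial.hasFiniteQuotients F
  Ring.HasFiniteQuotients.of_module_finite F[X] _

end Norm

variable [Algebra F K] [IsScalarTower F F[X] K]

theorem FFPlace.forall_ringOfIntegers_mem_iff (P : FFPlace F K) :
    (∀ x : ringOfIntegers F K, algebraMap _ K x ∈ P.ring) ↔ ¬ P.IsInfinite := by
  rw [FFPlace.IsInfinite, not_lt, val_le_one_iff]
  constructor
  · intro h
    exact h (algebraMap F[X] _ Polynomial.X)
  · intro h x
    refine P.mem_of_isIntegral (R := F[X]) (fun p => ?_) x.2
    induction p using Polynomial.induction_on' with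
    | add p q hp hq => rw [map_add]; exact add_mem hp hq
    | monomial n c =>
      rw [← Polynomial.C_mul_X_pow_eq_monomial, map_mul, map_pow, ← Polynomial.algebraMap_eq,
        ← IsScalarTower.algebraMap_apply F F[X] K]
      exact mul_mem (P.algebraMap_mem c) (pow_mem h n)

theorem FunctionField.ringOfIntegers.algebraMap_mem_range (c : F) :
    algebraMap F K c ∈ (algebraMap (ringOfIntegers F K) K).range :=
  ⟨algebraMap F[X] _ (Polynomial.C c), by
    rw [← IsScalarTower.algebraMap_apply, ← Polynomial.algebraMap_eq,
      ← IsScalarTower.algebraMap_apply F F[X] K]⟩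

variable [Algebra (RatFunc F) K] [IsScalarTower F[X] (RatFunc F) K] [FunctionField F K]
  [Algebra.IsSeparable (RatFunc F) K]

theorem FunctionField.ringOfIntegers.mem_range_of_forall {x : K}
    (hx : ∀ P : FFPlace F K, ¬ P.IsInfinite → x ∈ P.ring) :
    x ∈ (algebraMap (ringOfIntegers F K) K).range := by
  refine HeightOneSpectrum.mem_integers_of_valuation_le_one K x fun v => ?_
  rw [← FFPlace.val_toFFPlace algebraMap_mem_range, FFPlace.val_le_one_iff]
  exact hx _ ((FFPlace.forall_ringOfIntegers_mem_iff _).1 (FFPlace.algebraMap_mem_toFFPlace _ v))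

/-- Every nonzero function has a divisor, and its degree is zero. -/
theorem FFDivisor.exists_principal [Finite F] [IsScalarTower F (RatFunc F) K] {a : F[X]}
    {b : F} {f : K} {σ : K ≃ₐ[F] K} (h : IsQuadraticUnitExtension a b f σ) {P : FFPlace F K}
    (hP : P.IsInfinite) (hf : P.val f < 1) (x : Kˣ) :
    ∃ D : FFDivisor F K, (∀ Q, D Q = Q.ord x) ∧ FFDivisor.degree F K D = 0 := by
  classical
  -- It suffices to treat integral elements, since every function is a quotient of two of them.
  have key : ∀ z : ringOfIntegers F K, z ≠ 0 → ∃ D : FFDivisor F K,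
      (∀ Q : FFPlace F K, D Q = -log (Q.val (algebraMap _ K z))) ∧
      FFDivisor.degree F K D = 0 := by
    intro z hz
    have hz' : algebraMap _ K z ≠ 0 := by simpa using hz
    have : Infinite (ringOfIntegers F K) :=
      Infinite.of_injective _ (ringOfIntegers.algebraMap_injective F K)
    obtain ⟨D, h1, h2, h3⟩ := FFDivisor.exists_ofElement (F := F) (K := K)
      ringOfIntegers.algebraMap_mem_range hz
    have hne := h.ne_comap hP hf
    have hfree : Module.Free F[X] (ringOfIntegers F K) :=
      have : Module.IsTorsionFree F[X] K := .trans_faithfulSMul F[X] (RatFunc F) K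
      IsIntegralClosure.module_free F[X] (RatFunc F) K _
    have h2' : ∀ Q : FFPlace F K, Q.IsInfinite → D Q = 0 := fun Q hQ => by
      refine h2 Q ?_
      by_contra! h4
      exact (Q.forall_ringOfIntegers_mem_iff).1 h4 hQ
    refine ⟨D + Finsupp.single P (-log (P.val (algebraMap _ K z))) +
      Finsupp.single (P.comap σ) (-log ((P.comap σ).val (algebraMap _ K z))), fun Q => ?_, ?_⟩
    · rw [Finsupp.add_apply, Finsupp.add_apply, Finsupp.single_apply, Finsupp.single_apply]
      by_cases hQ : Q.IsInfinite
      · rw [h2' Q hQ]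
        rcases h.eq_or_eq_comap hP hf hQ with rfl | rfl
        · simp [hne.symm]
        · simp [hne]
      · have h4 : P ≠ Q := by rintro rfl; exact hQ hP
        have h5 : P.comap σ ≠ Q := by rintro rfl; exact hQ (h.isInfinite_comap hP)
        rw [if_neg h4, if_neg h5, add_zero, add_zero]
        exact h1 Q ((Q.forall_ringOfIntegers_mem_iff).2 hQ)
    -- The finite part has degree `dim O_K / (z)`, which is the degree of the norm of `z`. The two
    -- infinite places contribute its negative.
    · have h4 := congrArg log (h.val_mul_val_comap hP hf hz')
      rw [log_mul (by simpa using hz) (by simpa using hz), log_exp,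
        ← ringOfIntegers.natDegree_norm,
        ← finrank_quotient_span_eq_natDegree_norm (Module.Free.chooseBasis _ _) hz] at h4
      rw [map_add, map_add, h3]
      simp only [FFDivisor.degree, Finsupp.liftAddHom_apply_single, zmultiplesHom_apply,
        h.degree_eq_one hP hf, h.degree_comap_eq_one hP hf]
      rw [← h4]
      simp
  obtain ⟨n, d, hd, hx⟩ := IsFractionRing.div_surjective (A := ringOfIntegers F K) (x : K)
  have hd := nonZeroDivisors.ne_zero hd
  have hn : n ≠ 0 := by rintro rfl; simp [eq_comm] at hx
  obtain ⟨D, h1, h2⟩ := key n hn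
  obtain ⟨E, h3, h4⟩ := key d hd
  refine ⟨D - E, fun Q => ?_, by rw [map_sub, h2, h4, sub_zero]⟩
  rw [Finsupp.sub_apply, h1, h3, FFPlace.ord_eq, ← hx, map_div₀,
    log_div (by simpa using hn) (by simpa using hd)]
  ring

end RingOfIntegers
end

/-! ### The ring of functions regular outside one infinite place is Dedekind -/

section


section RegularOutside

open FunctionField

variable {F K : Type*} [Field F] [Field K] [Algebra F K]

theorem mem_regularOutside_iff {P : FFPlace F K} {x : K} :
    x ∈ regularOutside P ↔ ∀ Q : FFPlace F K, Q ≠ P → x ∈ Q.ring := by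
  simp [regularOutside, Subring.mem_iInf]

variable [Algebra F[X] K] [Algebra (RatFunc F) K]
  [IsScalarTower F F[X] K] [IsScalarTower F[X] (RatFunc F) K] [IsScalarTower F (RatFunc F) K]
  {a : F[X]} {b : F} {f : K} {σ : K ≃ₐ[F] K} {P : FFPlace F K}

namespace IsQuadraticUnitExtension

/-- The element `a - f` is integral over `F[T]` and small at the conjugate place, so `P` is its only
pole. It serves to separate `P` from the other places and to clear poles. -/
theorem conj_root_mem_regularOutside (h : IsQuadraticUnitExtension a b f σ) (hP : P.IsInfinite)
    (hf : P.val f < 1) : algebraMap F[X] K a - f ∈ regularOutside P := by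
  rw [mem_regularOutside_iff]
  intro Q hQP
  by_cases hQ : Q.IsInfinite
  · rcases h.eq_or_eq_comap hP hf hQ with rfl | rfl
    · exact absurd rfl hQP
    · rw [← FFPlace.val_le_one_iff]
      exact (h.val_comap_conj_root_lt_one hf).le
  · refine Q.mem_of_isIntegral (R := ringOfIntegers F K)
      (Q.forall_ringOfIntegers_mem_iff.2 hQ) ?_
    have hint : IsIntegral F[X] (algebraMap F[X] K a - f) := by
      refine ⟨Polynomial.X ^ 2 - Polynomial.C a * Polynomial.X - Polynomial.C (Polynomial.C b), ?_, ?_⟩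
      · monicity!
      · have h1 := h.mul_conj
        have h2 : algebraMap F[X] K (Polynomial.C b) = algebraMap F K b := by
          rw [← Polynomial.algebraMap_eq, ← IsScalarTower.algebraMap_apply F F[X] K]
        simp only [Polynomial.eval₂_sub, Polynomial.eval₂_mul, Polynomial.eval₂_pow,
          Polynomial.eval₂_X, Polynomial.eval₂_C, h2]
        linear_combination -h1
    exact isIntegral_algebraMap (R := ringOfIntegers F K) (A := K)
      (x := ⟨algebraMap F[X] K a - f, hint⟩)

theorem forall_regularOutside_mem_iff (h : IsQuadraticUnitExtension a b f σ) (hP : P.IsInfinite)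
    (hf : P.val f < 1) (Q : FFPlace F K) :
    (∀ x : regularOutside P, algebraMap (regularOutside P) K x ∈ Q.ring) ↔ Q ≠ P := by
  constructor
  · rintro h1 rfl
    have h2 := h1 ⟨_, h.conj_root_mem_regularOutside hP hf⟩
    rw [← FFPlace.val_le_one_iff] at h2
    exact (h.one_lt_val_conj_root hP hf).not_ge h2
  · intro hQ x
    exact mem_regularOutside_iff.1 x.2 Q hQ

variable [FunctionField F K]

/-- An integral element can fail to be regular outside `P` only at the conjugate place. A high power
of `a - f`, which vanishes there, removes that pole; numerator and denominator are multiplied by the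
same power. -/
theorem isFractionRing_regularOutside (h : IsQuadraticUnitExtension a b f σ) (hP : P.IsInfinite)
    (hf : P.val f < 1) : IsFractionRing (regularOutside P) K := by
  set g := algebraMap F[X] K a - f with hg
  have hg0 : g ≠ 0 := h.symm.root_ne_zero
  have hgA := h.conj_root_mem_regularOutside hP hf
  have key : ∀ z : ringOfIntegers F K, ∀ᶠ n : ℕ in Filter.atTop,
      algebraMap _ K z * g ^ n ∈ regularOutside P := by
    intro z
    filter_upwards [Filter.eventually_ge_atTop (log ((P.comap σ).val (algebraMap _ K z))).toNat]
      with n hn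
    rw [mem_regularOutside_iff]
    intro Q hQP
    by_cases hQ : Q.IsInfinite
    · rcases h.eq_or_eq_comap hP hf hQ with rfl | rfl
      · exact absurd rfl hQP
      · by_cases hz : z = 0
        · rw [hz, map_zero, zero_mul]
          exact zero_mem _
        have hz0 : (P.comap σ).val (algebraMap _ K z) ≠ 0 := by simpa using hz
        have h1 := h.val_comap_conj_root_lt_one hf
        rw [← hg, ← exp_log (x := (P.comap σ).val g) (by simpa using hg0), ← exp_zero,
          exp_lt_exp] at h1
        rw [← FFPlace.val_le_one_iff, map_mul, map_pow, ← exp_log hz0,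
          ← exp_log (x := (P.comap σ).val g) (by simpa using hg0), ← exp_nsmul, ← exp_add,
          ← exp_zero, exp_le_exp, nsmul_eq_mul]
        have h2 : (n : ℤ) * log ((P.comap σ).val g) ≤ n * (-1) := by
          gcongr
          omega
        omega
    · exact mul_mem (Q.forall_ringOfIntegers_mem_iff.2 hQ z)
        (pow_mem (mem_regularOutside_iff.1 hgA Q hQP) n)
  refine IsFractionRing.of_field _ _ fun z => ?_
  obtain ⟨x, y, hy, rfl⟩ := IsFractionRing.div_surjective (A := ringOfIntegers F K) z
  obtain ⟨n, hx, hy'⟩ := ((key x).and (key y)).exists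
  refine ⟨⟨_, hx⟩, ⟨_, hy'⟩, ?_⟩
  exact (mul_div_mul_right _ _ (pow_ne_zero n hg0)).symm

variable [Algebra.IsSeparable (RatFunc F) K]

/-- The ring is the intersection of `O_K` with the valuation ring of the conjugate place. An element
divisible by `x` in both is divisible by `x` in the intersection, so the quotient by `x` embeds in a
product of two finite quotients. -/
theorem hasFiniteQuotients_regularOutside [Finite F] (h : IsQuadraticUnitExtension a b f σ)
    (hP : P.IsInfinite) (hf : P.val f < 1) : Ring.HasFiniteQuotients (regularOutside P) where
  finiteQuotient {I} hI := by
    set Q := P.comap σ with hQ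
    obtain ⟨x, hxI, hx0⟩ := Submodule.exists_mem_ne_zero_of_ne_bot hI
    have hx0' : (x : K) ≠ 0 := by simpa using hx0
    have hQP : Q ≠ P := (h.ne_comap hP hf).symm
    have hB : ∀ y : regularOutside P, IsIntegral F[X] (y : K) := fun y => by
      obtain ⟨z, hz⟩ := ringOfIntegers.mem_range_of_forall (F := F) (x := (y : K)) fun R hR =>
        mem_regularOutside_iff.1 y.2 R (by rintro rfl; exact hR hP)
      rw [← hz]
      exact z.2
    let i₁ : regularOutside P →+* ringOfIntegers F K :=
      (regularOutside P).subtype.codRestrict (ringOfIntegers F K) hB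
    let i₂ : regularOutside P →+* Q.ring :=
      (regularOutside P).subtype.codRestrict Q.ring fun y => mem_regularOutside_iff.1 y.2 Q hQP
    have hi₁ : i₁ x ≠ 0 := fun h0 => hx0' (congrArg Subtype.val h0)
    have hi₂ : i₂ x ≠ 0 := fun h0 => hx0' (congrArg Subtype.val h0)
    have : Finite (IsLocalRing.ResidueField Q.ring) := by
      have h1 : Module.finrank F (IsLocalRing.ResidueField Q.ring) = 1 :=
        h.degree_comap_eq_one hP hf
      have : Module.Finite F (IsLocalRing.ResidueField Q.ring) :=
        Module.finite_of_finrank_pos (by omega)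
      exact Module.finite_of_finite F
    have := IsDiscreteValuationRing.hasFiniteQuotients Q.ring
    have : Finite (ringOfIntegers F K ⧸ Ideal.span {i₁ x}) :=
      Ring.HasFiniteQuotients.finiteQuotient (by simpa using hi₁)
    have : Finite (Q.ring ⧸ Ideal.span {i₂ x}) :=
      Ring.HasFiniteQuotients.finiteQuotient (by simpa using hi₂)
    let φ : regularOutside P →+*
        (ringOfIntegers F K ⧸ Ideal.span {i₁ x}) × (Q.ring ⧸ Ideal.span {i₂ x}) :=
      ((Ideal.Quotient.mk _).comp i₁).prod ((Ideal.Quotient.mk _).comp i₂)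
    have hker : RingHom.ker φ ≤ I := by
      intro y hy
      have hy' : φ y = 0 := hy
      obtain ⟨u, hu⟩ := Ideal.mem_span_singleton.1
        (Ideal.Quotient.eq_zero_iff_mem.1 (congrArg Prod.fst hy'))
      obtain ⟨w, hw⟩ := Ideal.mem_span_singleton.1
        (Ideal.Quotient.eq_zero_iff_mem.1 (congrArg Prod.snd hy'))
      have hu' : (y : K) = x * (u : K) := congrArg Subtype.val hu
      have hw' : (y : K) = x * (w : K) := congrArg Subtype.val hw
      have huw : (u : K) = w := mul_left_cancel₀ hx0' (hu'.symm.trans hw')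
      have huA : (u : K) ∈ regularOutside P := by
        rw [mem_regularOutside_iff]
        intro R hRP
        by_cases hR : R.IsInfinite
        · rcases h.eq_or_eq_comap hP hf hR with rfl | rfl
          · exact absurd rfl hRP
          · rw [huw]
            exact w.2
        · exact R.forall_ringOfIntegers_mem_iff.2 hR u
      have : y = x * ⟨u, huA⟩ := Subtype.ext hu'
      rw [this]
      exact I.mul_mem_right _ hxI
    have : Finite (regularOutside P ⧸ RingHom.ker φ) :=
      Finite.of_injective _ (RingHom.kerLift_injective φ)
    exact Finite.of_surjective _ (Ideal.Quotient.factor_surjective hker)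

/-- Finite quotients give the Noetherian property and dimension at most one. Integral closedness is
inherited from the valuation rings whose intersection is taken. -/
theorem isDedekindDomain_regularOutside [Finite F] (h : IsQuadraticUnitExtension a b f σ)
    (hP : P.IsInfinite) (hf : P.val f < 1) : IsDedekindDomain (regularOutside P) := by
  have := h.isFractionRing_regularOutside hP hf
  have := h.hasFiniteQuotients_regularOutside hP hf
  have : IsIntegrallyClosed (regularOutside P) := by
    refine (isIntegrallyClosed_iff K).2 fun {x} hx => ⟨⟨x, ?_⟩, rfl⟩
    rw [mem_regularOutside_iff]
    exact fun Q hQ => Q.mem_of_isIntegral (fun y => mem_regularOutside_iff.1 y.2 Q hQ) hx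
  exact { }

end IsQuadraticUnitExtension
end RegularOutside
end

/-! ### Comparison of the three class groups -/

section


open FunctionField

namespace FFDivisor

variable {F K : Type*} [Field F] [Field K] [Algebra F K]

theorem degree_single (P : FFPlace F K) (n : ℤ) :
    degree F K (Finsupp.single P n) = n * P.degree := by
  simp [degree]

/-- A homomorphism which is trivial on principal divisors, on the group of degree zero classes. -/
def liftDegreeZero {C : Type*} [AddCommGroup C] (φ : FFDivisor F K →+ C)
    (hφ : ∀ D, ∀ x : Kˣ, (∀ P, D P = P.ord x) → φ D = 0) : FFDegreeZeroClassGroup F K →+ C :=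
  QuotientAddGroup.lift _ (φ.comp (degree F K).ker.subtype) fun D hD => by
    obtain ⟨x, hx⟩ := hD
    exact hφ D x hx

theorem liftDegreeZero_mk {C : Type*} [AddCommGroup C] (φ : FFDivisor F K →+ C)
    (hφ : ∀ D, ∀ x : Kˣ, (∀ P, D P = P.ord x) → φ D = 0) (D : (degree F K).ker) :
    liftDegreeZero φ hφ (QuotientAddGroup.mk D) = φ D := rfl

theorem mk_eq_zero_iff (D : (degree F K).ker) :
    (QuotientAddGroup.mk D : FFDegreeZeroClassGroup F K) = 0 ↔
      ∃ x : Kˣ, ∀ P, (D : FFDivisor F K) P = P.ord x :=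
  QuotientAddGroup.eq_zero_iff D

/-- Any divisor is moved to degree zero by subtracting a multiple of a place of degree one, which
`φ` does not see. -/
theorem liftDegreeZero_surjective {C : Type*} [AddCommGroup C] {φ : FFDivisor F K →+ C}
    (hφ : ∀ D, ∀ x : Kˣ, (∀ P, D P = P.ord x) → φ D = 0) (hsurj : Function.Surjective φ)
    {P : FFPlace F K} (hP : P.degree = 1) (hφP : ∀ n, φ (Finsupp.single P n) = 0) :
    Function.Surjective (liftDegreeZero φ hφ) := by
  intro c
  obtain ⟨D, rfl⟩ := hsurj c
  refine ⟨QuotientAddGroup.mk ⟨D - Finsupp.single P (degree F K D), ?_⟩, ?_⟩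
  · rw [AddMonoidHom.mem_ker, map_sub, degree_single, hP]
    simp
  · rw [liftDegreeZero_mk, map_sub, hφP, sub_zero]

end FFDivisor

namespace IsQuadraticUnitExtension

open FFDivisor

variable {F K : Type*} [Field F] [Field K] [Algebra F K] [Algebra F[X] K] [Algebra (RatFunc F) K]
  [IsScalarTower F F[X] K] [IsScalarTower F[X] (RatFunc F) K] [IsScalarTower F (RatFunc F) K]
  {a : F[X]} {b : F} {f : K} {σ : K ≃ₐ[F] K} {P : FFPlace F K}

/-- The divisor class of the difference of the two places over infinity. -/
def inftyClass (h : IsQuadraticUnitExtension a b f σ) (hP : P.IsInfinite) (hf : P.val f < 1) :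
    FFDegreeZeroClassGroup F K :=
  QuotientAddGroup.mk ⟨Finsupp.single P 1 - Finsupp.single (P.comap σ) 1, by
    rw [AddMonoidHom.mem_ker, map_sub, degree_single, degree_single, h.degree_eq_one hP hf,
      h.degree_comap_eq_one hP hf, sub_self]⟩

theorem zsmul_inftyClass_eq_zero_iff (h : IsQuadraticUnitExtension a b f σ) (hP : P.IsInfinite)
    (hf : P.val f < 1) (n : ℤ) : n • h.inftyClass hP hf = 0 ↔
      ∃ x : Kˣ, P.ord x = n ∧ (P.comap σ).ord x = -n ∧
        ∀ Q : FFPlace F K, ¬ Q.IsInfinite → Q.ord x = 0 := by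
  classical
  rw [inftyClass, ← QuotientAddGroup.mk_zsmul, mk_eq_zero_iff]
  have hne := h.ne_comap hP hf
  refine exists_congr fun x => ?_
  have hcoe : ∀ Q : FFPlace F K, ((n • (⟨Finsupp.single P 1 - Finsupp.single (P.comap σ) 1, by
      rw [AddMonoidHom.mem_ker, map_sub, degree_single, degree_single, h.degree_eq_one hP hf,
        h.degree_comap_eq_one hP hf, sub_self]⟩ : (degree F K).ker) :
        (degree F K).ker) : FFDivisor F K) Q =
      (if P = Q then n else 0) - (if P.comap σ = Q then n else 0) := fun Q => by
    simp [Finsupp.single_apply, mul_sub]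
  simp only [hcoe]
  constructor
  · intro hx
    refine ⟨?_, ?_, fun Q hQ => ?_⟩
    · rw [← hx, if_pos rfl, if_neg hne.symm, sub_zero]
    · rw [← hx, if_neg hne, if_pos rfl, zero_sub]
    · rw [← hx, if_neg (by rintro rfl; exact hQ hP),
        if_neg (by rintro rfl; exact hQ (h.isInfinite_comap hP)), sub_zero]
  · rintro ⟨h1, h2, h3⟩ Q
    by_cases hQ : Q.IsInfinite
    · rcases h.eq_or_eq_comap hP hf hQ with rfl | rfl
      · rw [h1, if_pos rfl, if_neg hne.symm, sub_zero]
      · rw [h2, if_neg hne, if_pos rfl, zero_sub]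
    · rw [h3 Q hQ, if_neg (by rintro rfl; exact hQ hP),
        if_neg (by rintro rfl; exact hQ (h.isInfinite_comap hP)), sub_zero]

/-- The witness is `f`. At finite places `f` and `a - f` are both regular with constant product, so
`f` is a unit there. -/
theorem natDegree_zsmul_inftyClass (h : IsQuadraticUnitExtension a b f σ) (hP : P.IsInfinite)
    (hf : P.val f < 1) : (a.natDegree : ℤ) • h.inftyClass hP hf = 0 := by
  have hlog := h.log_val_root hP hf
  refine (h.zsmul_inftyClass_eq_zero_iff hP hf _).2 ⟨Units.mk0 f h.root_ne_zero, ?_, ?_, ?_⟩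
  · rw [FFPlace.ord_eq, Units.val_mk0, hlog.1, neg_neg]
  · rw [FFPlace.ord_eq, Units.val_mk0, hlog.2]
  · intro Q hQ
    have h1 : Q.val (algebraMap F[X] K a - f) ≤ 1 := by
      refine Q.val_le_one_iff.2 (mem_regularOutside_iff.1 (h.conj_root_mem_regularOutside hP hf) Q ?_)
      rintro rfl
      exact hQ hP
    have h2 : Q.val f ≤ 1 := by
      have := h.symm.conj_root_mem_regularOutside (h.isInfinite_comap hP)
        (h.val_comap_conj_root_lt_one hf)
      rw [sub_sub_cancel] at this
      refine Q.val_le_one_iff.2 (mem_regularOutside_iff.1 this Q ?_)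
      rintro rfl
      exact hQ (h.isInfinite_comap hP)
    have h3 := congrArg Q.val h.mul_conj
    rw [map_mul, Valuation.map_neg, Q.val_algebraMap h.ne_zero] at h3
    have h4 : Q.val f = 1 := by
      refine le_antisymm h2 ?_
      rw [← h3]
      exact mul_le_of_le_one_right' h1
    rw [FFPlace.ord_eq, Units.val_mk0, h4, log_one, neg_zero]

variable [FunctionField F K] [Algebra.IsSeparable (RatFunc F) K]

/-- A relation of length `m` yields a function without finite zeros or poles, that is, a unit of
`O_K`, whose order at `P` is `m`. Being a constant times a power of `f`, it has order divisible by
`d`. -/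
theorem addOrderOf_inftyClass (h : IsQuadraticUnitExtension a b f σ) (hP : P.IsInfinite)
    (hf : P.val f < 1)
    (hu : ∀ u : (ringOfIntegers F K)ˣ, ∃ (c : Fˣ) (n : ℤ),
      algebraMap (ringOfIntegers F K) K u = algebraMap F K c * f ^ n) :
    addOrderOf (h.inftyClass hP hf) = a.natDegree := by
  refine Nat.dvd_antisymm (addOrderOf_dvd_of_nsmul_eq_zero ?_) ?_
  · rw [← natCast_zsmul, h.natDegree_zsmul_inftyClass]
  · have h1 := addOrderOf_nsmul_eq_zero (h.inftyClass hP hf)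
    rw [← natCast_zsmul, zsmul_inftyClass_eq_zero_iff] at h1
    obtain ⟨x, hx1, -, hx2⟩ := h1
    have hmem : ∀ y : Kˣ, (∀ Q : FFPlace F K, ¬ Q.IsInfinite → Q.ord y = 0) →
        ∃ z, algebraMap (ringOfIntegers F K) K z = y := fun y hy => by
      refine ringOfIntegers.mem_range_of_forall fun Q hQ => ?_
      rw [← FFPlace.val_le_one_iff, FFPlace.val_eq_exp, hy Q hQ]
      simp
    obtain ⟨y, hy⟩ := hmem x hx2
    obtain ⟨z, hz⟩ := hmem x⁻¹ fun Q hQ => by rw [FFPlace.ord_inv, hx2 Q hQ, neg_zero]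
    have hyz : y * z = 1 := by
      apply IsFractionRing.injective (ringOfIntegers F K) K
      rw [map_mul, hy, hz, map_one, Units.mul_inv]
    obtain ⟨c, n, hc⟩ := hu ⟨y, z, hyz, by rw [mul_comm, hyz]⟩
    have hc' : (x : K) = algebraMap F K c * f ^ n := by
      rw [← hy, ← hc]
    rw [FFPlace.ord_eq, hc', map_mul, P.val_algebraMap c.ne_zero, one_mul, map_zpow₀, log_zpow,
      (h.log_val_root hP hf).1] at hx1
    rw [← Int.natCast_dvd_natCast, ← hx1]
    exact ⟨n, by rw [smul_eq_mul]; ring⟩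

theorem nonempty_equiv_classGroup_regularOutside [Finite F] (h : IsQuadraticUnitExtension a b f σ)
    (hP : P.IsInfinite) (hf : P.val f < 1) :
    Nonempty (FFDegreeZeroClassGroup F K ≃ ClassGroup (regularOutside P)) := by
  have := h.isFractionRing_regularOutside hP hf
  have := h.isDedekindDomain_regularOutside hP hf
  have hF : ∀ c : F, algebraMap F K c ∈ (algebraMap (regularOutside P) K).range := fun c =>
    ⟨⟨algebraMap F K c, mem_regularOutside_iff.2 fun Q _ => Q.algebraMap_mem c⟩, rfl⟩
  have hker : ∀ D : FFDivisor F K, toClassGroup hF D = 0 ↔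
      ∃ x : Kˣ, ∀ Q : FFPlace F K, Q ≠ P → D Q = Q.ord x := fun D => by
    rw [toClassGroup_eq_zero_iff]
    simp only [h.forall_regularOutside_mem_iff hP hf]
  have hφ : ∀ D : FFDivisor F K, ∀ x : Kˣ, (∀ Q, D Q = Q.ord x) → toClassGroup hF D = 0 :=
    fun D x hx => (hker D).2 ⟨x, fun Q _ => hx Q⟩
  have hsurj := liftDegreeZero_surjective hφ (toClassGroup_surjective hF)
    (h.degree_eq_one hP hf) fun n => (hker _).2 ⟨1, fun Q hQ => by
      rw [Finsupp.single_eq_of_ne hQ, Q.ord_one]⟩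
  have hinj : Function.Injective (liftDegreeZero (toClassGroup hF) hφ) := by
    rw [injective_iff_map_eq_zero]
    intro c hc
    obtain ⟨D, rfl⟩ := QuotientAddGroup.mk_surjective c
    rw [liftDegreeZero_mk, hker] at hc
    obtain ⟨x, hx⟩ := hc
    obtain ⟨E, hE, hE0⟩ := exists_principal h hP hf x
    rw [mk_eq_zero_iff]
    refine ⟨x, fun Q => ?_⟩
    by_cases hQ : Q = P
    · subst hQ
      -- `D` and the principal divisor `E` differ only at a place of degree one. Both have degree
      -- zero, so the difference vanishes.
      have h1 : (D : FFDivisor F K) - E = Finsupp.single Q ((D : FFDivisor F K) Q - E Q) := by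
        classical
        ext R
        by_cases hR : R = Q
        · rw [hR, Finsupp.single_eq_same, Finsupp.sub_apply]
        · rw [Finsupp.single_eq_of_ne hR, Finsupp.sub_apply, hx R hR, hE, sub_self]
      have h2 := congrArg (degree F K) h1
      rw [map_sub, hE0, degree_single, h.degree_eq_one hP hf, (AddMonoidHom.mem_ker).1 D.2] at h2
      push_cast at h2
      rw [← hE]
      linarith
    · exact hx Q hQ
  exact ⟨(Equiv.ofBijective _ ⟨hinj, hsurj⟩).trans Additive.toMul⟩

theorem card_degreeZeroClassGroup [Finite F] (h : IsQuadraticUnitExtension a b f σ)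
    (hP : P.IsInfinite) (hf : P.val f < 1) :
    Nat.card (FFDegreeZeroClassGroup F K) =
      addOrderOf (h.inftyClass hP hf) * Nat.card (ClassGroup (ringOfIntegers F K)) := by
  have hF := ringOfIntegers.algebraMap_mem_range (F := F) (K := K)
  have hker : ∀ D : FFDivisor F K, toClassGroup hF D = 0 ↔
      ∃ x : Kˣ, ∀ Q : FFPlace F K, ¬ Q.IsInfinite → D Q = Q.ord x := fun D => by
    rw [toClassGroup_eq_zero_iff]
    simp only [FFPlace.forall_ringOfIntegers_mem_iff]
  have hφ : ∀ D : FFDivisor F K, ∀ x : Kˣ, (∀ Q, D Q = Q.ord x) → toClassGroup hF D = 0 :=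
    fun D x hx => (hker D).2 ⟨x, fun Q _ => hx Q⟩
  have hsurj := liftDegreeZero_surjective hφ (toClassGroup_surjective hF)
    (h.degree_eq_one hP hf) fun n => (hker _).2 ⟨1, fun Q hQ => by
      rw [Finsupp.single_eq_of_ne (by rintro rfl; exact hQ hP), Q.ord_one]⟩
  have hne := h.ne_comap hP hf
  have hψ : (liftDegreeZero (toClassGroup hF) hφ).ker =
      AddSubgroup.zmultiples (h.inftyClass hP hf) := by
    ext c
    obtain ⟨D, rfl⟩ := QuotientAddGroup.mk_surjective c
    rw [AddMonoidHom.mem_ker, AddSubgroup.mem_zmultiples_iff]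
    constructor
    · intro hc
      rw [liftDegreeZero_mk, hker] at hc
      obtain ⟨x, hx⟩ := hc
      obtain ⟨E, hE, hE0⟩ := exists_principal h hP hf x
      -- The difference lives on the two infinite places, both of degree one. Total degree zero
      -- makes the coefficients opposite, which exhibits a multiple of the infinity class.
      have h1 : (D : FFDivisor F K) - E =
          Finsupp.single P ((D : FFDivisor F K) P - E P) +
            Finsupp.single (P.comap σ) ((D : FFDivisor F K) (P.comap σ) - E (P.comap σ)) := by
        ext R
        rw [Finsupp.add_apply, Finsupp.sub_apply]
        by_cases hR : R.IsInfinite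
        · rcases h.eq_or_eq_comap hP hf hR with rfl | rfl
          · rw [Finsupp.single_eq_same, Finsupp.single_eq_of_ne hne, add_zero]
          · rw [Finsupp.single_eq_same, Finsupp.single_eq_of_ne hne.symm, zero_add]
        · rw [Finsupp.single_eq_of_ne (by rintro rfl; exact hR hP),
            Finsupp.single_eq_of_ne (by rintro rfl; exact hR (h.isInfinite_comap hP)),
            hx R hR, hE, sub_self, add_zero]
      have h2 := congrArg (degree F K) h1
      rw [map_sub, map_add, hE0, degree_single, degree_single, h.degree_eq_one hP hf,
        h.degree_comap_eq_one hP hf, (AddMonoidHom.mem_ker).1 D.2] at h2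
      refine ⟨(D : FFDivisor F K) P - E P, ?_⟩
      rw [inftyClass, ← QuotientAddGroup.mk_zsmul, ← sub_eq_zero, ← QuotientAddGroup.mk_sub,
        mk_eq_zero_iff]
      refine ⟨x⁻¹, fun Q => ?_⟩
      rw [FFPlace.ord_inv, ← hE]
      have h3 := DFunLike.congr_fun h1 Q
      have h4 : (D : FFDivisor F K) (P.comap σ) - E (P.comap σ) =
          -((D : FFDivisor F K) P - E P) := by
        push_cast at h2
        linarith
      rw [h4] at h3
      classical
      simp only [Finsupp.sub_apply, Finsupp.add_apply, Finsupp.single_apply] at h3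
      simp only [AddSubgroup.coe_sub, AddSubgroup.coe_zsmul, Finsupp.sub_apply,
        Finsupp.smul_apply, Finsupp.single_apply, smul_eq_mul]
      split_ifs at h3 ⊢ <;> linarith
    · rintro ⟨n, hn⟩
      rw [← hn, map_zsmul]
      have : liftDegreeZero (toClassGroup hF) hφ (h.inftyClass hP hf) = 0 := by
        rw [inftyClass, liftDegreeZero_mk, hker]
        refine ⟨1, fun Q hQ => ?_⟩
        rw [Finsupp.sub_apply, Finsupp.single_eq_of_ne (by rintro rfl; exact hQ hP),
          Finsupp.single_eq_of_ne (by rintro rfl; exact hQ (h.isInfinite_comap hP)),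
          Q.ord_one, sub_self]
      rw [this, smul_zero]
  have hcard := AddSubgroup.card_mul_index (liftDegreeZero (toClassGroup hF) hφ).ker
  rw [AddSubgroup.index_ker, AddMonoidHom.range_eq_top.2 hsurj, AddSubgroup.card_top, hψ,
    Nat.card_zmultiples] at hcard
  rw [← hcard]
  congr 1

theorem class_number_formula [Finite F] (h : IsQuadraticUnitExtension a b f σ)
    (hP : P.IsInfinite) (hf : P.val f < 1) :
    Finite (FFDegreeZeroClassGroup F K) ∧
    Finite (ClassGroup (regularOutside P)) ∧
    Finite (ClassGroup (ringOfIntegers F K)) ∧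
    Nat.card (FFDegreeZeroClassGroup F K) = Nat.card (ClassGroup (regularOutside P)) ∧
    ((∀ u : (ringOfIntegers F K)ˣ, ∃ (c : Fˣ) (n : ℤ),
      algebraMap (ringOfIntegers F K) K u = algebraMap F K c * f ^ n) →
      Nat.card (ClassGroup (regularOutside P)) =
        a.natDegree * Nat.card (ClassGroup (ringOfIntegers F K))) := by
  have hfin : Finite (ClassGroup (ringOfIntegers F K)) := by
    have := Fintype.ofFinite F
    infer_instance
  obtain ⟨e⟩ := h.nonempty_equiv_classGroup_regularOutside hP hf
  have hcard := h.card_degreeZeroClassGroup hP hf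
  have hfin0 : Finite (FFDegreeZeroClassGroup F K) := by
    apply Nat.finite_of_card_ne_zero
    rw [hcard]
    refine mul_ne_zero ?_ Nat.card_pos.ne'
    rw [ne_eq, addOrderOf_eq_zero_iff, not_not, isOfFinAddOrder_iff_zsmul_eq_zero]
    exact ⟨a.natDegree, by have := h.natDegree_pos; omega, h.natDegree_zsmul_inftyClass hP hf⟩
  refine ⟨hfin0, Finite.of_equiv _ e, hfin, Nat.card_congr e, fun hu => ?_⟩
  rw [← Nat.card_congr e, hcard, h.addOrderOf_inftyClass hP hf hu]

end IsQuadraticUnitExtension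
end

end

/-! ### The concrete field `k(f)` inside the completion -/

/-- A rational root would be integral, hence a polynomial `p` with `p (a - p)` constant and nonzero.
Then `p` and `a - p` are constants, and so is their sum `a`. -/
theorem RatFunc.not_root_of_natDegree_pos {F : Type*} [Field F] {a : F[X]} (ha : 0 < a.natDegree)
    {b : F} (hb : b ≠ 0) (r : RatFunc F) :
    r * (algebraMap F[X] (RatFunc F) a - r) ≠ -algebraMap F (RatFunc F) b := by
  intro hr
  have hbC : algebraMap F[X] (RatFunc F) (Polynomial.C b) = algebraMap F (RatFunc F) b := by
    rw [← Polynomial.algebraMap_eq, ← IsScalarTower.algebraMap_apply F F[X] (RatFunc F)]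
  have hint : IsIntegral F[X] r := by
    refine ⟨Polynomial.X ^ 2 - Polynomial.C a * Polynomial.X - Polynomial.C (Polynomial.C b), ?_, ?_⟩
    · monicity!
    · simp only [Polynomial.eval₂_sub, Polynomial.eval₂_mul, Polynomial.eval₂_pow,
        Polynomial.eval₂_X, Polynomial.eval₂_C, hbC]
      linear_combination -hr
  obtain ⟨p, rfl⟩ := IsIntegrallyClosed.isIntegral_iff.1 hint
  rw [← hbC, ← map_sub, ← map_mul, ← map_neg,
    (FaithfulSMul.algebraMap_injective F[X] (RatFunc F)).eq_iff] at hr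
  have hne : p * (a - p) ≠ 0 := by
    rw [hr]
    simpa using hb
  have hdeg := congrArg Polynomial.natDegree hr
  rw [Polynomial.natDegree_mul (left_ne_zero_of_mul hne) (right_ne_zero_of_mul hne),
    Polynomial.natDegree_neg, Polynomial.natDegree_C] at hdeg
  have h1 := Polynomial.natDegree_add_le_of_le (n := 0) (m := 0) (p := a - p) (q := p)
    (by omega) (by omega)
  rw [sub_add_cancel] at h1
  simp at h1
  omega

section

variable {F : Type*} [Field F] [DecidableEq (RatFunc F)] {a : F[X]} {b : F}
  {f : RatFunc.CompletionAtInfty F}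

instance : IsScalarTower F F[X] (simpleExt f) :=
  IsScalarTower.of_algebraMap_eq fun c => Subtype.ext
    (IsScalarTower.algebraMap_apply F F[X] (RatFunc.CompletionAtInfty F) c)

theorem exists_isQuadraticUnitExtension (ha : 0 < a.natDegree) (hb : b ≠ 0)
    (hf : f ^ 2 - algebraMap F[X] (RatFunc.CompletionAtInfty F) a * f
      - algebraMap F (RatFunc.CompletionAtInfty F) b = 0) :
    FunctionField F (simpleExt f) ∧ Algebra.IsSeparable (RatFunc F) (simpleExt f) ∧
      ∃ σ : simpleExt f ≃ₐ[F] simpleExt f, IsQuadraticUnitExtension a b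
        (IntermediateField.AdjoinSimple.gen (RatFunc F) f) σ := by
  set a' : RatFunc F := algebraMap F[X] (RatFunc F) a with ha'
  set b' : RatFunc F := algebraMap F (RatFunc F) b with hb'
  have haL : algebraMap (RatFunc F) (RatFunc.CompletionAtInfty F) a' =
      algebraMap F[X] (RatFunc.CompletionAtInfty F) a := (IsScalarTower.algebraMap_apply ..).symm
  have hbL : algebraMap (RatFunc F) (RatFunc.CompletionAtInfty F) b' =
      algebraMap F (RatFunc.CompletionAtInfty F) b := (IsScalarTower.algebraMap_apply ..).symm
  let g : (RatFunc F)[X] := Polynomial.X ^ 2 - Polynomial.C a' * Polynomial.X - Polynomial.C b'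
  have hg : g.Monic := by
    simp only [g]
    monicity!
  have hgdeg : g.natDegree = 2 := by
    simp only [g]
    compute_degree!
  have hgf : Polynomial.aeval f g = 0 := by
    simp only [g, map_sub, map_mul, map_pow, Polynomial.aeval_X, Polynomial.aeval_C, haL, hbL]
    exact hf
  have hint : IsIntegral (RatFunc F) f := ⟨g, hg, hgf⟩
  have hfin : FunctionField F (simpleExt f) := IntermediateField.adjoin.finiteDimensional hint
  have hgsep : g.Separable := by
    -- The discriminant is nonzero in every characteristic because `a ^ 2` is not constant; in
    -- characteristic two it is just `a ^ 2`.
    have hdisc : a' ^ 2 + 4 * b' ≠ 0 := by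
      have : a' ^ 2 + 4 * b' = algebraMap F[X] (RatFunc F) (a ^ 2 + Polynomial.C (4 * b)) := by
        rw [map_add, map_pow, ← Polynomial.algebraMap_eq,
          ← IsScalarTower.algebraMap_apply F F[X] (RatFunc F), map_mul, map_ofNat]
      rw [this, ne_eq, FaithfulSMul.algebraMap_eq_zero_iff]
      intro h0
      have h1 := congrArg Polynomial.natDegree (eq_neg_of_add_eq_zero_left h0)
      rw [Polynomial.natDegree_pow, Polynomial.natDegree_neg, Polynomial.natDegree_C] at h1
      omega
    -- The Bézout coefficients come from `(2X - a)² - 4(X² - aX - b) = a² + 4b`, divided by the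
    -- discriminant.
    refine ⟨Polynomial.C (-4 / (a' ^ 2 + 4 * b')),
      Polynomial.C (1 / (a' ^ 2 + 4 * b')) * (2 * Polynomial.X - Polynomial.C a'), ?_⟩
    have hder : Polynomial.derivative g = 2 * Polynomial.X - Polynomial.C a' := by
      simp only [g, Polynomial.derivative_sub, Polynomial.derivative_X_pow,
        Polynomial.derivative_C_mul, Polynomial.derivative_X, Polynomial.derivative_C]
      norm_num
      exact map_ofNat Polynomial.C 2
    have h1 : Polynomial.C (1 / (a' ^ 2 + 4 * b')) *
        (Polynomial.C a' ^ 2 + 4 * Polynomial.C b') = 1 := by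
      have : (4 : (RatFunc F)[X]) = Polynomial.C 4 := (map_ofNat Polynomial.C 4).symm
      rw [this, ← Polynomial.C_pow, ← Polynomial.C_mul, ← Polynomial.C_add, ← Polynomial.C_mul,
        one_div_mul_cancel hdisc, Polynomial.C_1]
    have h2 : Polynomial.C (-4 / (a' ^ 2 + 4 * b')) =
        -4 * Polynomial.C (1 / (a' ^ 2 + 4 * b')) := by
      have : (-4 : (RatFunc F)[X]) = Polynomial.C (-4) := by rw [map_neg, map_ofNat]
      rw [this, ← Polynomial.C_mul]
      congr 1
      ring
    rw [hder, h2]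
    simp only [g]
    linear_combination h1
  have hsep : Algebra.IsSeparable (RatFunc F) (simpleExt f) :=
    (IntermediateField.isSeparable_adjoin_simple_iff_isSeparable _ _).2
      (hgsep.of_dvd (minpoly.dvd (RatFunc F) f hgf))
  refine ⟨hfin, hsep, ?_⟩
  set x := IntermediateField.AdjoinSimple.gen (RatFunc F) f with hx
  have haK : algebraMap (RatFunc F) (simpleExt f) a' = algebraMap F[X] (simpleExt f) a :=
    (IsScalarTower.algebraMap_apply ..).symm
  have hbK : algebraMap (RatFunc F) (simpleExt f) b' = algebraMap F (simpleExt f) b :=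
    (IsScalarTower.algebraMap_apply ..).symm
  have hxmul : x * (algebraMap F[X] (simpleExt f) a - x) = -algebraMap F (simpleExt f) b := by
    apply Subtype.ext
    change f * (algebraMap F[X] (RatFunc.CompletionAtInfty F) a - f) =
      -algebraMap F (RatFunc.CompletionAtInfty F) b
    linear_combination -hf
  have hnot : ∀ r : RatFunc F, algebraMap (RatFunc F) (simpleExt f) r ≠ x := by
    intro r hr
    apply RatFunc.not_root_of_natDegree_pos ha hb r
    apply (algebraMap (RatFunc F) (simpleExt f)).injective
    rw [map_mul, map_sub, map_neg, hr, haK, hbK]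
    exact hxmul
  have hmin : (minpoly (RatFunc F) f).natDegree ≤ 2 :=
    hgdeg ▸ Polynomial.natDegree_le_of_dvd (minpoly.dvd (RatFunc F) f hgf) hg.ne_zero
  have hrep : ∀ z : simpleExt f, ∃ u v : RatFunc F, z = algebraMap _ _ u + algebraMap _ _ v * x := by
    intro z
    obtain ⟨p, hp, rfl⟩ := (IntermediateField.adjoin.powerBasis hint).exists_eq_aeval z
    rw [IntermediateField.adjoin.powerBasis_dim] at hp
    obtain ⟨v, u, rfl⟩ := Polynomial.exists_eq_X_add_C_of_natDegree_le_one (p := p) (by omega)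
    refine ⟨u, v, ?_⟩
    rw [IntermediateField.adjoin.powerBasis_gen]
    simp [add_comm, hx]
  have hrank : Module.finrank (RatFunc F) (simpleExt f) = 2 := by
    rw [IntermediateField.adjoin.finrank hint]
    refine le_antisymm hmin ?_
    rw [minpoly.two_le_natDegree_iff hint]
    rintro ⟨r, hr⟩
    exact hnot r (Subtype.ext hr)
  have : Algebra.IsQuadraticExtension (RatFunc F) (simpleExt f) := ⟨hrank⟩
  have hcard : Nat.card Gal(simpleExt f/RatFunc F) = 2 := by
    rw [IsGalois.card_aut_eq_finrank, hrank]
  obtain ⟨σ, hσ1, hσ⟩ : ∃ σ : Gal(simpleExt f/RatFunc F), σ ≠ 1 ∧ ∀ τ, τ = 1 ∨ τ = σ := by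
    obtain ⟨σ, hσ, hσ'⟩ := Nat.card_eq_two_iff' (1 : Gal(simpleExt f/RatFunc F)) |>.1 hcard
    exact ⟨σ, hσ, fun τ => or_iff_not_imp_left.2 fun h => hσ' τ h⟩
  have hσx : σ x = algebraMap F[X] (simpleExt f) a - x := by
    have h1 := congrArg σ hxmul
    rw [← haK, ← hbK, map_mul, map_sub, map_neg, σ.commutes, σ.commutes, hbK, ← hxmul, ← haK] at h1
    -- The image of `x` is a root of the same quadratic. It cannot be `x`, since `σ` would then fix
    -- all of `K`.
    have h2 : (σ x - x) * (algebraMap (RatFunc F) (simpleExt f) a' - x - σ x) = 0 := by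
      linear_combination h1
    rcases mul_eq_zero.1 h2 with h3 | h3
    · refine absurd (AlgEquiv.ext fun z => ?_) hσ1
      obtain ⟨u, v, rfl⟩ := hrep z
      rw [map_add, map_mul, σ.commutes, σ.commutes, sub_eq_zero.1 h3]
      rfl
    · rw [← haK]
      linear_combination -h3
  refine ⟨σ.restrictScalars F, ha, hb, hxmul, hrep, hσx, fun p => ?_, fun z => ?_⟩
  · rw [IsScalarTower.algebraMap_apply F[X] (RatFunc F) (simpleExt f)]
    exact σ.commutes _
  · classical
    rw [Algebra.norm_eq_prod_automorphisms]
    have : (Finset.univ : Finset Gal(simpleExt f/RatFunc F)) = {1, σ} := by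
      ext τ
      simpa using hσ τ
    rw [this, Finset.prod_pair hσ1.symm]
    rfl

end

/-! ### Assembly for an arbitrary place over infinity -/

theorem mainTheorem8 {F : Type*} [Field F] [Finite F] [DecidableEq (RatFunc F)]
    -- `f` is a quadratic unit in `k_∞`: a root of `X² - aX - b`, where `d = deg a > 0`, `b ∈ F^*`
    (a : F[X]) (ha : 0 < a.natDegree) (b : F) (hb : b ≠ 0)
    (f : RatFunc.CompletionAtInfty F)
    (hf : f ^ 2 - algebraMap F[X] (RatFunc.CompletionAtInfty F) a * f
      - algebraMap F (RatFunc.CompletionAtInfty F) b = 0)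
    -- a point of the curve of `K = k(f)` over `∞`
    (infty₁ : FFPlace F (simpleExt f)) (h_infty : infty₁.LiesOverInfty) :
    Finite (FFDegreeZeroClassGroup F (simpleExt f)) ∧
    Finite (ClassGroup (regularOutside infty₁)) ∧
    Finite (ClassGroup (FunctionField.ringOfIntegers F (simpleExt f))) ∧
    Nat.card (FFDegreeZeroClassGroup F (simpleExt f)) =
      Nat.card (ClassGroup (regularOutside infty₁)) ∧
    (IsFundamentalUnit f →
      Nat.card (ClassGroup (regularOutside infty₁)) =
        a.natDegree * Nat.card (ClassGroup (FunctionField.ringOfIntegers F (simpleExt f)))) := by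
  obtain ⟨_, _, σ, h⟩ := exists_isQuadraticUnitExtension ha hb hf
  have hinf : infty₁.IsInfinite := by
    rw [FFPlace.IsInfinite, ← not_le, FFPlace.val_le_one_iff,
      IsScalarTower.algebraMap_apply F[X] (RatFunc F) (simpleExt f)]
    change ¬ RatFunc.X ∈ infty₁.ring.comap (algebraMap (RatFunc F) (simpleExt f))
    rw [h_infty, Valuation.mem_valuationSubring_iff, RatFunc.inftyValuation.X,
      ← WithZero.exp_zero, WithZero.exp_le_exp]
    norm_num
  have hunit : IsFundamentalUnit f → ∀ u : (FunctionField.ringOfIntegers F (simpleExt f))ˣ,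
      ∃ (c : Fˣ) (n : ℤ),
        algebraMap _ (simpleExt f) (u : FunctionField.ringOfIntegers F (simpleExt f)) =
        algebraMap F (simpleExt f) c * IntermediateField.AdjoinSimple.gen (RatFunc F) f ^ n := by
    intro hfund u
    obtain ⟨c, n, hcn⟩ := (hfund _).1 ⟨u, rfl⟩
    exact ⟨c, n, Subtype.ext hcn⟩
  -- The given place may be the one where `f` is large. In that case `a - f` plays the role of `f`.
  rcases hinf.val_root_lt_one_or ha hb h.mul_conj with hlt | hlt
  · obtain ⟨h1, h2, h3, h4, h5⟩ := h.class_number_formula hinf hlt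
    exact ⟨h1, h2, h3, h4, fun hfund => h5 (hunit hfund)⟩
  · obtain ⟨h1, h2, h3, h4, h5⟩ := h.symm.class_number_formula hinf hlt
    refine ⟨h1, h2, h3, h4, fun hfund => h5 fun u => ?_⟩
    obtain ⟨c, n, hcn⟩ := hunit hfund u
    have hmul := h.mul_conj
    set x := IntermediateField.AdjoinSimple.gen (RatFunc F) f
    have hx0 : algebraMap F[X] (simpleExt f) a - x ≠ 0 := h.symm.root_ne_zero
    have hx : x = algebraMap F (simpleExt f) (-b) * (algebraMap F[X] (simpleExt f) a - x)⁻¹ := by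
      rw [map_neg, ← hmul, mul_inv_cancel_right₀ hx0]
    -- Since `f = -b (a - f)⁻¹`, powers of `f` are constants times powers of `a - f` with the
    -- opposite exponent, so `a - f` is fundamental as well.
    refine ⟨c * Units.mk0 (-b) (neg_ne_zero.2 hb) ^ n, -n, ?_⟩
    rw [hcn]
    conv_lhs => rw [hx]
    rw [mul_zpow, inv_zpow', Units.val_mul, Units.val_zpow_eq_zpow_val, Units.val_mk0, map_mul,
      map_zpow₀, mul_assoc]
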